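/- Let $\lambda>0$, $\mu>0$ and $0<\nu\le 1$, and let $\frac{\mathrm d^\alpha}{\mathrm dt^\alpha}$ denote the Caputo derivative of order $\alpha>0$ with base point $0$: for $n=\lceil\alpha\rceil$, it is $f^{(n)}(t)$ if $\alpha=n$, and $\frac{1}{\Gamma(n-\alpha)}\int_0^t \frac{f^{(n)}(s)}{(t-s)^{\alpha-n+1}}\,\mathrm ds$ if $\alpha<n$ (where $f$ is $C^{n-1}$ on $[0,\infty)$, $f^{(n-1)}$ is locally absolutely continuous there, and the integral converges absolutely for every $t>0$). A *fractional linear birth–death process* of order $\nu$ with rates $\lambda,\mu$ is an $\mathbb N_0$-valued process $N_\nu(t)$, $t\ge 0$, whose state probabilities $p_k(t)=\Pr\{N_\nu(t)=k\}$, $k\ge 0$, satisfy $p_k(0)=\delta_{k,1}$ and $$\frac{\mathrm d^\nu p_k(t)}{\mathrm dt^\nu}=-(\lambda+\mu)k\,p_k(t)+\lambda(k-1)p_{k-1}(t)+\mu(k+1)p_{k+1}(t),\qquad k\ge 1,\ t>0 .$$ Let $N(t)$, $t\ge 0$, be the classical linear birth–death process with birth rates $\lambda k$, death rates $\mu k$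 and $N(0)=1$, that is, the right-continuous time-homogeneous Markov chain whose transition probabilities satisfy, from each initial state, the above system with $\nu=1$. Let $T_{2\nu}(t)\ge 0$, $t\ge 0$, be random variables on the same probability space such that each $T_{2\nu}(t)$ is independent of the process $N$ and has as its law the folded solution (the image under $x\mapsto|x|$) of the fractional diffusion equation $$\frac{\partial^{2\nu}q}{\partial t^{2\nu}}=\frac{\partial^2 q}{\partial x^2},\qquad x\in\mathbb R,\ t>0,$$ with $q(x,0)=\delta(x)$ and, if $\tfrac12<\nu\le 1$, also $q_t(x,0)=0$. Here $q(\cdot,t)$, $t\ge0$, is a family of probability measures on $\mathbb R$, and the equation and the initial conditions hold in the sense of distributions in $x$: for every $\varphi\in C_c^\infty(\mathbb R)$, the function $F_\varphi(t)=\int\varphi(x)\,q(\mathrm dx,t)$ satisfies $\frac{\mathrm d^{2\nu}}{\mathrm dt^{2\nu}}F_\varphi(t)=\int\varphi''(x)\,q(\mathrm dx,t)$ for $t>0$, $F_\varphi(0)=\varphi(0)$ and, if $\nu>\frac12$, $F_\varphi'(0)=0$. Then $N(T_{2\nu}(t))$, $t\ge 0$, is a fractional linear birth–death process of order $\nu$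 with rates $\lambda,\mu$, and every fractional linear birth–death process $N_\nu$ of order $\nu$ with rates $\lambda,\mu$ has the same one-dimensional distributions: $$N_\nu(t)\stackrel{d}{=}N(T_{2\nu}(t)),\qquad t\ge 0 .$$ -/

import Mathlib

open MeasureTheory ProbabilityTheory Set
open scoped NNReal

noncomputable section

namespace FracBD

/-- `D` is, on `(0, ∞)`, the Caputo (Dzherbashyan–Caputo) derivative of order `α > 0` of `f`, with
base point `0`. With `n = ⌈α⌉`, the function `f` is `C^(n-1)` on `[0, ∞)`, its derivative of order
`n - 1` is absolutely continuous on every `[0, t]`, and for every `t > 0`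
* if `α = n`, then `D t` is the ordinary derivative `f^(n)(t)`;
* if `α < n`, then `D t = 1 / Γ(n - α) * ∫₀ᵗ f^(n)(s) (t - s)^(n - α - 1) ds`, the integral being
  absolutely convergent. -/
structure HasCaputoDeriv (α : ℝ) (f D : ℝ → ℝ) : Prop where
  contDiffOn : ContDiffOn ℝ ((⌈α⌉₊ - 1 : ℕ) : WithTop ℕ∞) f (Ici 0)
  absolutelyContinuous : ∀ t : ℝ, 0 < t →
    AbsolutelyContinuousOnInterval (iteratedDerivWithin (⌈α⌉₊ - 1) f (Ici 0)) 0 t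
  eq_of_integer : α = ⌈α⌉₊ → ∀ t : ℝ, 0 < t →
    HasDerivAt (iteratedDerivWithin (⌈α⌉₊ - 1) f (Ici 0)) (D t) t
  integrable_of_noninteger : α ≠ ⌈α⌉₊ → ∀ t : ℝ, 0 < t →
    IntervalIntegrable
      (fun s => deriv (iteratedDerivWithin (⌈α⌉₊ - 1) f (Ici 0)) s * (t - s) ^ (⌈α⌉₊ - α - 1))
      volume 0 t
  eq_of_noninteger : α ≠ ⌈α⌉₊ → ∀ t : ℝ, 0 < t →
    D t = 1 / Real.Gamma (⌈α⌉₊ - α) *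
      ∫ s in (0 : ℝ)..t,
        deriv (iteratedDerivWithin (⌈α⌉₊ - 1) f (Ici 0)) s * (t - s) ^ (⌈α⌉₊ - α - 1)

/-- The functions `p k`, `k = 0, 1, 2, …`, on `[0, ∞)` form, at each time, a probability
distribution on `ℕ`, equal at time `0` to the unit mass at `i`, and solve the system
`d^ν p_k / dt^ν = -(λ + μ) k p_k + λ (k - 1) p_{k-1} + μ (k + 1) p_{k+1}`, `k ≥ 1`. -/
structure SolvesBirthDeathSystem (ν birth death : ℝ) (i : ℕ) (p : ℕ → ℝ → ℝ) : Prop where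
  nonneg : ∀ k t, 0 ≤ t → 0 ≤ p k t
  hasSum_one : ∀ t, 0 ≤ t → HasSum (fun k => p k t) 1
  initial : ∀ k, p k 0 = if k = i then 1 else 0
  equation : ∀ k : ℕ, 1 ≤ k → HasCaputoDeriv ν (p k) (fun t =>
    -(birth + death) * k * p k t + birth * ((k : ℝ) - 1) * p (k - 1) t
      + death * ((k : ℝ) + 1) * p (k + 1) t)

/-- The state probabilities `t ↦ Pr {X t = k}` of an `ℕ`-valued process (only `t ≥ 0` matters). -/
def stateProb {Ω : Type*} [MeasurableSpace Ω] (P : Measure Ω) (X : ℝ≥0 → Ω → ℕ) (k : ℕ) (t : ℝ) :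
    ℝ :=
  P.real {ω | X t.toNNReal ω = k}

/-- A fractional linear birth–death process of order `ν` with one progenitor: a process whose state
probabilities solve the fractional system and which starts at `1`. As in the definition of the
process, nothing is required of its finite-dimensional distributions. -/
structure IsFractionalLinearBirthDeath {Ω : Type*} [MeasurableSpace Ω] (ν birth death : ℝ)
    (P : Measure Ω) (X : ℝ≥0 → Ω → ℕ) : Prop where
  measurable : ∀ t, Measurable (X t)
  stateProb_solves : SolvesBirthDeathSystem ν birth death 1 (stateProb P X)

/-- The classical linear birth–death process with one progenitor: a time-homogeneous Markov chain
on `ℕ` with right-continuous paths, started at `1`, whose transition probabilities `p i j t` solve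
Kolmogorov's forward equations with birth rates `λ k` and death rates `μ k`. -/
structure IsClassicalLinearBirthDeath {Ω : Type*} [MeasurableSpace Ω] (birth death : ℝ)
    (P : Measure Ω) (N : ℝ≥0 → Ω → ℕ) : Prop where
  measurable : ∀ t, Measurable (N t)
  right_continuous : ∀ ω s, ContinuousWithinAt (fun r => N r ω) (Ici s) s
  initial : ∀ᵐ ω ∂P, N 0 ω = 1
  markov : ∃ p : ℕ → ℕ → ℝ → ℝ,
    (∀ i, SolvesBirthDeathSystem 1 birth death i (p i)) ∧
    ∀ (s t : ℝ≥0) (i j : ℕ) (A : Set Ω),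
      MeasurableSet[⨆ r : Iic s, MeasurableSpace.comap (N r) ⊤] A →
      P.real (A ∩ {ω | N s ω = i} ∩ {ω | N (s + t) ω = j}) =
        P.real (A ∩ {ω | N s ω = i}) * p i j t

/-- The family of probability measures `q t` (to be thought of as `q(x, t) dx`), `t ≥ 0`, is the
fundamental solution of `∂^α q / ∂t^α = ∂² q / ∂x²` on `ℝ`, `0 < α ≤ 2`: the equation holds in the
sense of distributions in `x` (tested against compactly supported smooth `φ`), `q(x, 0) = δ(x)`,
and `q_t(x, 0) = 0` if `α > 1`. The solution has to be a family of measures since it has no density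
for `α = 2`, and the equation has to be weak in `x` since the density has a corner at `x = 0`
for `1 ≠ α < 2`. -/
structure IsFundamentalSolution (α : ℝ) (q : ℝ → Measure ℝ) : Prop where
  isProbabilityMeasure : ∀ t, 0 ≤ t → IsProbabilityMeasure (q t)
  initial : q 0 = Measure.dirac 0
  equation : ∀ φ : ℝ → ℝ, ContDiff ℝ ((⊤ : ℕ∞) : WithTop ℕ∞) φ → HasCompactSupport φ →
    HasCaputoDeriv α (fun t => ∫ x, φ x ∂(q t)) (fun t => ∫ x, iteratedDeriv 2 φ x ∂(q t))
  initial_deriv : 1 < α → ∀ φ : ℝ → ℝ, ContDiff ℝ ((⊤ : ℕ∞) : WithTop ℕ∞) φ → HasCompactSupport φ →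
    HasDerivWithinAt (fun t => ∫ x, φ x ∂(q t)) 0 (Ici 0) 0

/-- The folding of a measure on `ℝ` onto the half-line: the image under `x ↦ |x|`. A density `q`
becomes `q(x) + q(-x)`, `x > 0`. -/
def fold (m : Measure ℝ) : Measure ℝ≥0 :=
  m.map Real.nnabs

end FracBD

end

noncomputable section

namespace FracBD

/-! Everything is done on the Laplace side, after the Caputo equations have been turned into
Volterra equations with Riemann–Liouville integrals.

For the diffusion, the weak equation is extended from test functions to `cos (ξ x)` and `sin (ξ x)`.
The eigenfunction relation then gives `u ∫ e^{-ut} E cos(ξ X_t) dt = 1 / (1 + ξ² u^{-2ν})`, where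
`X_t` has law `q t`, and zero for the sine. The right side is the characteristic function of the
two-sided exponential law of rate `u^ν`: at an independent exponential time of rate `u`, the folded
solution is exponential of rate `u^ν` (`map_expLaw_prod`, `laplace_integral_abs`). The same formula
yields the self-similarity `X_t ~ t^ν X_1` (`eq_map_mul`).

Let `f' = d`, `G t = E f(|X_t|)` and `H t = E d(|X_t|)`. With hats for Laplace transforms, `u Ĝ(u) =
u^ν f̂(u^ν) = f 0 + d̂(u^ν) = G 0 + u^{1-ν} Ĥ(u)`, which is the transformed statement that `H` is
the Caputo derivative of `G`. Self-similarity supplies the regularity needed to invert it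
(`hasCaputoDeriv_integral_abs`). Taking for `f` the classical state probabilities, with `d` the
right side of the system, gives the fractional system for `N (T t)`.

For uniqueness, the transforms of two solutions differ by a summable solution of a resolvent
recursion. A nonzero solution would dominate a multiple of the harmonic series
(`eq_zero_of_summable_of_resolvent`), so the state probabilities with `k ≥ 1` agree, and total mass
one settles `k = 0`. -/

/-! ### Laplace transforms of fractional integrals -/

/-- The Riemann–Liouville fractional integral of order `a` with base point `0`. -/
def fracInt (a : ℝ) (g : ℝ → ℝ) (t : ℝ) : ℝ :=
  1 / Real.Gamma a * ∫ s in (0 : ℝ)..t, g s * (t - s) ^ (a - 1)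

/-- The Laplace transform. -/
def laplace (g : ℝ → ℝ) (u : ℝ) : ℝ :=
  ∫ t in Ioi (0 : ℝ), Real.exp (-(u * t)) * g t

/-- The Laplace integral of `g` at `u` converges absolutely. -/
def LaplaceIntegrable (g : ℝ → ℝ) (u : ℝ) : Prop :=
  IntegrableOn (fun t => Real.exp (-(u * t)) * g t) (Ioi (0 : ℝ))

theorem integrableOn_rpow_mul_exp {a u : ℝ} (ha : 0 < a) (hu : 0 < u) :
    IntegrableOn (fun t : ℝ => t ^ (a - 1) * Real.exp (-(u * t))) (Ioi 0) := by
  have h := Real.integral_rpow_mul_exp_neg_mul_Ioi ha hu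
  by_contra hc
  -- A nonintegrable function has integral `0` by convention, so a nonzero value proves
  -- integrability.
  rw [integral_undef hc] at h
  have : 0 < (1 / u) ^ a * Real.Gamma a :=
    mul_pos (Real.rpow_pos_of_pos (by positivity) _) (Real.Gamma_pos_of_pos ha)
  linarith

theorem LaplaceIntegrable.of_bound {g : ℝ → ℝ} {u a C : ℝ} (ha : 0 < a) (hu : 0 < u)
    (hm : AEStronglyMeasurable g (volume.restrict (Ioi 0)))
    (hb : ∀ t, 0 < t → |g t| ≤ C * t ^ (a - 1)) : LaplaceIntegrable g u := by
  refine Integrable.mono' ((integrableOn_rpow_mul_exp ha hu).const_mul C)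
    (AEStronglyMeasurable.mul (by fun_prop) hm) ?_
  filter_upwards [ae_restrict_mem measurableSet_Ioi] with t ht
  rw [norm_mul, Real.norm_eq_abs, Real.norm_eq_abs, abs_of_pos (Real.exp_pos _)]
  nlinarith [hb t ht, Real.exp_pos (-(u * t))]

theorem LaplaceIntegrable.of_bounded {g : ℝ → ℝ} {u C : ℝ} (hu : 0 < u)
    (hm : AEStronglyMeasurable g (volume.restrict (Ioi 0)))
    (hb : ∀ t, 0 < t → |g t| ≤ C) : LaplaceIntegrable g u :=
  .of_bound one_pos hu hm (C := C) (by simpa using hb)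

theorem laplace_const {u : ℝ} (hu : 0 < u) (c : ℝ) : laplace (fun _ => c) u = c / u := by
  unfold laplace
  rw [integral_mul_const]
  have := integral_exp_mul_Ioi (neg_lt_zero.2 hu) 0
  simp only [neg_mul, mul_zero, Real.exp_zero] at this
  rw [this]; field_simp

theorem laplace_congr {f g : ℝ → ℝ} (h : ∀ t, 0 < t → f t = g t) (u : ℝ) :
    laplace f u = laplace g u :=
  setIntegral_congr_fun measurableSet_Ioi fun t ht => by simp only [h t ht]

theorem laplace_add {f g : ℝ → ℝ} {u : ℝ} (hf : LaplaceIntegrable f u)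
    (hg : LaplaceIntegrable g u) :
    laplace (fun t => f t + g t) u = laplace f u + laplace g u := by
  unfold laplace
  rw [← integral_add hf hg]
  simp only [mul_add]

theorem laplace_sub {f g : ℝ → ℝ} {u : ℝ} (hf : LaplaceIntegrable f u)
    (hg : LaplaceIntegrable g u) :
    laplace (fun t => f t - g t) u = laplace f u - laplace g u := by
  unfold laplace
  rw [← integral_sub hf hg]
  simp only [mul_sub]

theorem laplace_const_mul (c : ℝ) (f : ℝ → ℝ) (u : ℝ) :
    laplace (fun t => c * f t) u = c * laplace f u := by
  unfold laplace
  rw [← integral_const_mul]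
  simp only [mul_left_comm]

theorem LaplaceIntegrable.add {f g : ℝ → ℝ} {u : ℝ} (hf : LaplaceIntegrable f u)
    (hg : LaplaceIntegrable g u) : LaplaceIntegrable (fun t => f t + g t) u := by
  unfold LaplaceIntegrable
  simp only [mul_add]
  exact Integrable.add hf hg

theorem LaplaceIntegrable.const_mul {f : ℝ → ℝ} {u : ℝ} (hf : LaplaceIntegrable f u) (c : ℝ) :
    LaplaceIntegrable (fun t => c * f t) u := by
  unfold LaplaceIntegrable
  simp only [mul_left_comm _ c]
  exact Integrable.const_mul hf c

theorem laplace_comp_mul_left (g : ℝ → ℝ) {c : ℝ} (hc : 0 < c) (u : ℝ) :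
    laplace (fun t => g (c * t)) u = c⁻¹ * laplace g (u / c) := by
  unfold laplace
  have := integral_comp_mul_left_Ioi (fun t => Real.exp (-(u / c * t)) * g t) 0 hc
  rw [mul_zero, smul_eq_mul] at this
  rw [← this]
  refine setIntegral_congr_fun measurableSet_Ioi fun t _ => ?_
  simp only
  congr 3
  field_simp

/-- Splitting `e^{-ut} = e^{-us} e^{-u(t-s)}` exhibits the weighted fractional integral as a
half-line convolution of two weighted functions, to which the convolution theorem applies. -/
theorem exp_mul_fracInt (a : ℝ) (g : ℝ → ℝ) (u t : ℝ) :
    Real.exp (-(u * t)) * fracInt a g t = 1 / Real.Gamma a *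
      ∫ s in (0 : ℝ)..t, ContinuousLinearMap.mul ℝ ℝ (Real.exp (-(u * s)) * g s)
        ((t - s) ^ (a - 1) * Real.exp (-(u * (t - s)))) := by
  unfold fracInt
  rw [mul_left_comm, ← intervalIntegral.integral_const_mul]
  congr 1
  refine intervalIntegral.integral_congr fun s _ => ?_
  simp only [ContinuousLinearMap.mul_apply']
  rw [show -(u * t) = -(u * s) + -(u * (t - s)) by ring, Real.exp_add]
  ring

theorem LaplaceIntegrable.fracInt {a u : ℝ} {g : ℝ → ℝ} (ha : 0 < a) (hu : 0 < u)
    (hg : LaplaceIntegrable g u) : LaplaceIntegrable (fracInt a g) u := by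
  have h := (integrable_posConvolution hg (integrableOn_rpow_mul_exp ha hu)
    (ContinuousLinearMap.mul ℝ ℝ)).integrableOn (s := Ioi 0)
  unfold LaplaceIntegrable
  simp only [exp_mul_fracInt]
  refine (IntegrableOn.congr_fun h (fun t ht => ?_) measurableSet_Ioi).const_mul _
  simp only [posConvolution, indicator_of_mem ht]

theorem laplace_fracInt {a u : ℝ} {g : ℝ → ℝ} (ha : 0 < a) (hu : 0 < u)
    (hg : LaplaceIntegrable g u) : laplace (fracInt a g) u = u ^ (-a) * laplace g u := by
  have h := integral_posConvolution hg (integrableOn_rpow_mul_exp ha hu)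
    (ContinuousLinearMap.mul ℝ ℝ)
  unfold laplace
  simp only [exp_mul_fracInt]
  rw [integral_const_mul, h, ContinuousLinearMap.mul_apply',
    Real.integral_rpow_mul_exp_neg_mul_Ioi ha hu, one_div u, Real.inv_rpow hu.le,
    Real.rpow_neg hu.le]
  have := Real.Gamma_pos_of_pos ha
  field_simp

/-! ### Beta integrals and the semigroup law -/

theorem integral_rpow_mul_sub_rpow {a b c : ℝ} (ha : 0 < a) (hb : 0 < b) (hc : 0 < c) :
    ∫ x in (0 : ℝ)..c, x ^ (a - 1) * (c - x) ^ (b - 1) = c ^ (a + b - 1) * beta a b := by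
  have h := Complex.betaIntegral_scaled a b hc
  rw [beta_eq_betaIntegralReal a b ha hb]
  have h1 : ∫ x in (0 : ℝ)..c, (x : ℂ) ^ ((a : ℂ) - 1) * ((c : ℂ) - x) ^ ((b : ℂ) - 1)
      = ((∫ x in (0 : ℝ)..c, x ^ (a - 1) * (c - x) ^ (b - 1) : ℝ) : ℂ) := by
    rw [← intervalIntegral.integral_ofReal]
    refine intervalIntegral.integral_congr fun x hx => ?_
    rw [uIcc_of_le hc.le] at hx
    push_cast
    rw [Complex.ofReal_cpow hx.1, Complex.ofReal_cpow (sub_nonneg.2 hx.2)]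
    push_cast; rfl
  rw [h1] at h
  have h2 := congrArg Complex.re h
  rw [Complex.ofReal_re, show ((a : ℂ) + b - 1) = ((a + b - 1 : ℝ) : ℂ) by push_cast; ring,
    ← Complex.ofReal_cpow hc.le, Complex.re_ofReal_mul] at h2
  exact h2

theorem integral_sub_rpow_mul_sub_rpow {a b r t : ℝ} (ha : 0 < a) (hb : 0 < b) (h : r < t) :
    ∫ s in r..t, (s - r) ^ (a - 1) * (t - s) ^ (b - 1) = (t - r) ^ (a + b - 1) * beta a b := by
  rw [← integral_rpow_mul_sub_rpow ha hb (sub_pos.2 h)]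
  have := intervalIntegral.integral_comp_sub_right (a := r) (b := t)
    (fun x => x ^ (a - 1) * (t - r - x) ^ (b - 1)) r
  rw [sub_self] at this
  rw [← this]
  refine intervalIntegral.integral_congr fun s _ => ?_
  rw [sub_sub_sub_cancel_right]

theorem intervalIntegrable_sub_rpow_mul_sub_rpow {a b r t : ℝ} (ha : 0 < a) (hb : 0 < b)
    (h : r < t) :
    IntervalIntegrable (fun s => (s - r) ^ (a - 1) * (t - s) ^ (b - 1)) volume r t := by
  by_contra hc
  have h1 := integral_sub_rpow_mul_sub_rpow ha hb h
  rw [intervalIntegral.integral_undef hc] at h1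
  have := mul_pos (Real.rpow_pos_of_pos (sub_pos.2 h) (a + b - 1)) (beta_pos ha hb)
  linarith

/-- The integrand of an iterated fractional integral. -/
def fracKernel (a b t : ℝ) (r s : ℝ) : ℝ :=
  (Ioc r t).indicator (fun s => (s - r) ^ (b - 1) * (t - s) ^ (a - 1)) s

theorem measurable_fracKernel (a b t : ℝ) :
    Measurable fun p : ℝ × ℝ => fracKernel a b t p.1 p.2 := by
  unfold fracKernel
  simp only [indicator_apply, mem_Ioc]
  refine Measurable.ite ?_ (by fun_prop) (by fun_prop)
  exact (measurableSet_lt measurable_fst measurable_snd).inter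
    (measurableSet_le measurable_snd measurable_const)

theorem fracKernel_nonneg {a b t : ℝ} (r s : ℝ) : 0 ≤ fracKernel a b t r s := by
  unfold fracKernel
  refine indicator_nonneg (fun s hs => ?_) s
  exact mul_nonneg (Real.rpow_nonneg (sub_nonneg.2 hs.1.le) _)
    (Real.rpow_nonneg (sub_nonneg.2 hs.2) _)

theorem integral_fracKernel {a b t r : ℝ} (ha : 0 < a) (hb : 0 < b) (hr : 0 ≤ r) (h : r < t) :
    Integrable (fracKernel a b t r) (volume.restrict (Ioc 0 t)) ∧
    ∫ s in Ioc 0 t, fracKernel a b t r s = (t - r) ^ (a + b - 1) * beta b a := by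
  have hsub : Ioc r t ⊆ Ioc 0 t := Ioc_subset_Ioc_left hr
  have hi := intervalIntegrable_sub_rpow_mul_sub_rpow hb ha h
  rw [intervalIntegrable_iff_integrableOn_Ioc_of_le h.le] at hi
  constructor
  · unfold fracKernel
    rw [integrable_indicator_iff measurableSet_Ioc, IntegrableOn,
      Measure.restrict_restrict measurableSet_Ioc, inter_eq_left.2 hsub]
    exact hi
  · unfold fracKernel
    rw [integral_indicator measurableSet_Ioc, Measure.restrict_restrict measurableSet_Ioc,
      inter_eq_left.2 hsub, ← intervalIntegral.integral_of_le h.le,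
      integral_sub_rpow_mul_sub_rpow hb ha h, add_comm b a]

/-- Fubini on the triangle `r < s ≤ t`: the inner integral is a Beta integral, and `B(b, a) = Γ(b)
Γ(a) / Γ(a + b)` cancels the constants. The condition `1 ≤ a + b` keeps `(t - r)^(a+b-1)` bounded,
so the identity holds at every `t` and not only almost everywhere. -/
theorem fracInt_fracInt {a b t : ℝ} {g : ℝ → ℝ} (ha : 0 < a) (hb : 0 < b) (hab : 1 ≤ a + b)
    (ht : 0 < t) (hg : IntervalIntegrable g volume 0 t) :
    fracInt a (fracInt b g) t = fracInt (a + b) g t := by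
  rw [intervalIntegrable_iff_integrableOn_Ioc_of_le ht.le] at hg
  have hne : ∀ᵐ r ∂volume.restrict (Ioc 0 t), r ∈ Ioo 0 t := by
    rw [← restrict_Ioo_eq_restrict_Ioc]
    exact ae_restrict_mem measurableSet_Ioo
  have hint : Integrable (fun p : ℝ × ℝ => g p.1 * fracKernel a b t p.1 p.2)
      ((volume.restrict (Ioc 0 t)).prod (volume.restrict (Ioc 0 t))) := by
    have hm : AEStronglyMeasurable (fun p : ℝ × ℝ => g p.1 * fracKernel a b t p.1 p.2)
        ((volume.restrict (Ioc 0 t)).prod (volume.restrict (Ioc 0 t))) :=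
      hg.aestronglyMeasurable.comp_fst.mul (measurable_fracKernel a b t).aestronglyMeasurable
    rw [integrable_prod_iff hm]
    constructor
    · filter_upwards [hne] with r hr
      exact (integral_fracKernel ha hb hr.1.le hr.2).1.const_mul _
    · refine Integrable.mono' ((hg.norm.const_mul (t ^ (a + b - 1) * beta b a)))
        hm.norm.integral_prod_right' ?_
      filter_upwards [hne] with r hr
      have h0 := beta_pos hb ha
      have h1 : ∫ s in Ioc 0 t, ‖g r * fracKernel a b t r s‖
          = ‖g r‖ * ((t - r) ^ (a + b - 1) * beta b a) := by
        simp only [norm_mul, Real.norm_of_nonneg (fracKernel_nonneg r _)]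
        rw [integral_const_mul, (integral_fracKernel ha hb hr.1.le hr.2).2]
      simp only [h1]
      rw [norm_mul, norm_norm, mul_comm, Real.norm_of_nonneg
        (mul_nonneg (Real.rpow_nonneg (sub_nonneg.2 hr.2.le) _) h0.le)]
      gcongr
      · exact sub_nonneg.2 hr.2.le
      · linarith [hr.1]
  have hswap := integral_integral_swap (f := fun r s => g r * fracKernel a b t r s) hint
  have hl : ∫ r in Ioc 0 t, ∫ s in Ioc 0 t, g r * fracKernel a b t r s
      = beta b a * ∫ r in Ioc 0 t, g r * (t - r) ^ (a + b - 1) := by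
    rw [← integral_const_mul]
    refine integral_congr_ae ?_
    filter_upwards [hne] with r hr
    rw [integral_const_mul, (integral_fracKernel ha hb hr.1.le hr.2).2]
    ring
  have hr : ∫ s in Ioc 0 t, ∫ r in Ioc 0 t, g r * fracKernel a b t r s
      = ∫ s in Ioc 0 t, (∫ r in (0 : ℝ)..s, g r * (s - r) ^ (b - 1)) * (t - s) ^ (a - 1) := by
    refine setIntegral_congr_fun measurableSet_Ioc fun s hs => ?_
    have hsub : Ioo 0 s ⊆ Ioc 0 t := Ioo_subset_Ioc_self.trans (Ioc_subset_Ioc_right hs.2)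
    rw [← intervalIntegral.integral_mul_const, intervalIntegral.integral_of_le hs.1.le,
      integral_Ioc_eq_integral_Ioo (x := 0) (y := s), ← inter_eq_left.2 hsub,
      ← Measure.restrict_restrict measurableSet_Ioo, ← integral_indicator measurableSet_Ioo]
    refine setIntegral_congr_fun measurableSet_Ioc fun r hr => ?_
    simp only [indicator_apply, fracKernel, mem_Ioc, mem_Ioo, hr.1, hs.2, and_true, true_and]
    split_ifs
    · ring
    · simp
  have hGa := Real.Gamma_pos_of_pos ha
  have hGb := Real.Gamma_pos_of_pos hb
  have hGab := Real.Gamma_pos_of_pos (add_pos ha hb)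
  rw [hl, hr] at hswap
  have hleft : fracInt a (fracInt b g) t = 1 / Real.Gamma a * (1 / Real.Gamma b *
      ∫ s in Ioc 0 t, (∫ r in (0 : ℝ)..s, g r * (s - r) ^ (b - 1)) * (t - s) ^ (a - 1)) := by
    unfold fracInt
    rw [intervalIntegral.integral_of_le ht.le, ← integral_const_mul (1 / Real.Gamma b)]
    simp only [mul_assoc]
  rw [hleft, ← hswap, fracInt, intervalIntegral.integral_of_le ht.le, beta, add_comm b a]
  field_simp

theorem fracInt_one (g : ℝ → ℝ) (t : ℝ) : fracInt 1 g t = ∫ s in (0 : ℝ)..t, g s := by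
  simp [fracInt]

theorem fracInt_zero_right (a : ℝ) (g : ℝ → ℝ) : fracInt a g 0 = 0 := by
  simp [fracInt]

/-! ### Injectivity of the Laplace transform -/

/-- A bounded continuous function on `[0, ∞)` whose Laplace transform vanishes is zero. -/
theorem eq_zero_of_laplace_eq_zero {g : ℝ → ℝ} {C : ℝ} (hc : ContinuousOn g (Ici 0))
    (hb : ∀ t, 0 ≤ t → |g t| ≤ C) (hL : ∀ u, 0 < u → laplace g u = 0) :
    ∀ t, 0 ≤ t → g t = 0 := by
  have hC : 0 ≤ C := (abs_nonneg _).trans (hb 0 le_rfl)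
  have hmg : AEStronglyMeasurable g (volume.restrict (Ioi 0)) :=
    (hc.mono Ioi_subset_Ici_self).aestronglyMeasurable measurableSet_Ioi
  -- Substitution `x = e^{-t}`. The extra factor `x` makes `h` continuous at `0`, where `g` at
  -- infinity is only bounded.
  set h : ℝ → ℝ := fun x => x * g (-Real.log x) with hh
  have hcont : ContinuousOn h (Icc 0 1) := by
    intro x hx
    rcases hx.1.eq_or_lt with rfl | hx0
    · have : Filter.Tendsto (fun x : ℝ => C * |x|) (nhdsWithin 0 (Icc 0 1)) (nhds 0) := by
        have : Continuous fun x : ℝ => C * |x| := by fun_prop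
        simpa using (this.tendsto 0).mono_left nhdsWithin_le_nhds
      rw [ContinuousWithinAt, hh]
      simp only [zero_mul]
      refine squeeze_zero_norm' ?_ this
      filter_upwards [self_mem_nhdsWithin] with y hy
      rw [norm_mul, mul_comm, Real.norm_eq_abs, Real.norm_eq_abs]
      gcongr
      exact hb _ (neg_nonneg.2 (Real.log_nonpos hy.1 hy.2))
    · refine ContinuousWithinAt.mul continuousWithinAt_id ?_
      refine ContinuousWithinAt.comp (t := Ici 0)
        (hc _ (neg_nonneg.2 (Real.log_nonpos hx.1 hx.2))) ?_ ?_
      · exact (Real.continuousAt_log hx0.ne').neg.continuousWithinAt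
      · intro y hy
        exact neg_nonneg.2 (Real.log_nonpos hy.1 hy.2)
  -- The monomial `x^i` corresponds to the Laplace transform at `u = i + 1`.
  have hpoly : ∀ p : Polynomial ℝ,
      ∫ t in Ioi (0 : ℝ), p.eval (Real.exp (-t)) * (Real.exp (-t) * g t) = 0 := by
    intro p
    have he : ∀ t, p.eval (Real.exp (-t)) * (Real.exp (-t) * g t) =
        ∑ i ∈ Finset.range (p.natDegree + 1),
          p.coeff i * (Real.exp (-(((i : ℝ) + 1) * t)) * g t) := by
      intro t
      rw [Polynomial.eval_eq_sum_range, Finset.sum_mul]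
      refine Finset.sum_congr rfl fun i _ => ?_
      rw [← Real.exp_nat_mul, show -(((i : ℝ) + 1) * t) = i * -t + -t by ring, Real.exp_add]
      ring
    simp only [he]
    rw [integral_finsetSum]
    · refine Finset.sum_eq_zero fun i _ => ?_
      rw [integral_const_mul]
      have := hL ((i : ℝ) + 1) (by positivity)
      rw [laplace] at this
      rw [this, mul_zero]
    · intro i _
      exact Integrable.const_mul (LaplaceIntegrable.of_bounded (u := (i : ℝ) + 1) (by positivity)
        hmg fun t ht => hb t ht.le) _
  have hi1 : IntegrableOn (fun t => Real.exp (-t) * g t) (Ioi 0) := by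
    simpa [LaplaceIntegrable] using LaplaceIntegrable.of_bounded (u := 1) one_pos hmg
      fun t ht => hb t ht.le
  have hexp : ∀ t : ℝ, 0 ≤ t → h (Real.exp (-t)) = Real.exp (-t) * g t := by
    intro t _; simp [hh]
  have hexpm : ∀ t : ℝ, 0 ≤ t → Real.exp (-t) ∈ Icc (0 : ℝ) 1 := fun t ht =>
    ⟨(Real.exp_pos _).le, Real.exp_le_one_iff.2 (by linarith)⟩
  obtain ⟨M, hM⟩ : ∃ M, ∀ x ∈ Icc (0 : ℝ) 1, ‖h x‖ ≤ M :=
    (isCompact_Icc.exists_bound_of_continuousOn hcont)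
  have hsqi : IntegrableOn (fun t => (Real.exp (-t) * g t) * (Real.exp (-t) * g t)) (Ioi 0) := by
    refine Integrable.bdd_mul (c := M) hi1 (AEStronglyMeasurable.mul (by fun_prop) hmg) ?_
    filter_upwards [ae_restrict_mem measurableSet_Ioi] with t ht
    rw [← hexp t (le_of_lt ht)]
    exact hM _ (hexpm t (le_of_lt ht))
  -- One factor of the square is `h (e^{-t})`. By Weierstrass it is replaced by a polynomial, whose
  -- contribution vanishes, at a cost of at most `ε K / (K + 1)`.
  have hsq : ∫ t in Ioi (0 : ℝ), (Real.exp (-t) * g t) * (Real.exp (-t) * g t) = 0 := by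
    set K := ∫ t in Ioi (0 : ℝ), ‖Real.exp (-t) * g t‖
    have hK : 0 ≤ K := integral_nonneg fun _ => norm_nonneg _
    rw [← abs_nonpos_iff]
    refine le_of_forall_pos_le_add fun ε hε => ?_
    obtain ⟨p, hp⟩ := exists_polynomial_near_of_continuousOn 0 1 h hcont (ε / (K + 1))
      (by positivity)
    have hpi : IntegrableOn (fun t => p.eval (Real.exp (-t)) * (Real.exp (-t) * g t)) (Ioi 0) := by
      refine Integrable.bdd_mul (c := M + ε / (K + 1)) hi1
        (by exact (p.continuous.comp (by fun_prop)).aestronglyMeasurable) ?_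
      filter_upwards [ae_restrict_mem measurableSet_Ioi] with t ht
      have h1 := hp _ (hexpm t (le_of_lt ht))
      have h2 := hM _ (hexpm t (le_of_lt ht))
      rw [Real.norm_eq_abs] at h2 ⊢
      have h3 := abs_add_le (p.eval (Real.exp (-t)) - h (Real.exp (-t))) (h (Real.exp (-t)))
      rw [sub_add_cancel] at h3
      linarith
    have hd : ∫ t in Ioi (0 : ℝ), (Real.exp (-t) * g t) * (Real.exp (-t) * g t)
        = ∫ t in Ioi (0 : ℝ), ((Real.exp (-t) * g t) * (Real.exp (-t) * g t)
          - p.eval (Real.exp (-t)) * (Real.exp (-t) * g t)) := by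
      rw [integral_sub hsqi hpi, hpoly, sub_zero]
    rw [hd, zero_add, ← Real.norm_eq_abs]
    have : ‖∫ t in Ioi (0 : ℝ), ((Real.exp (-t) * g t) * (Real.exp (-t) * g t)
          - p.eval (Real.exp (-t)) * (Real.exp (-t) * g t))‖
        ≤ ∫ t in Ioi (0 : ℝ), ε / (K + 1) * ‖Real.exp (-t) * g t‖ := by
      refine norm_integral_le_of_norm_le (hi1.norm.const_mul _) ?_
      filter_upwards [ae_restrict_mem measurableSet_Ioi] with t ht
      rw [← sub_mul, norm_mul]
      gcongr
      rw [← hexp t (le_of_lt ht), Real.norm_eq_abs, abs_sub_comm]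
      exact (hp _ (hexpm t (le_of_lt ht))).le
    refine this.trans ?_
    rw [integral_const_mul, div_mul_eq_mul_div, div_le_iff₀ (by positivity)]
    nlinarith
  have hae := (setIntegral_eq_zero_iff_of_nonneg_ae
    (Filter.Eventually.of_forall fun t => mul_self_nonneg _) hsqi).1 hsq
  have hz : EqOn (fun t => (Real.exp (-t) * g t) * (Real.exp (-t) * g t)) (fun _ => 0)
      (Ioi 0) := by
    refine Measure.eqOn_of_ae_eq (μ := volume) hae ?_ (by fun_prop) ?_
    · have := hc.mono (Ioi_subset_Ici_self)
      fun_prop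
    · rw [isOpen_Ioi.interior_eq]; exact subset_closure
  have hz' : EqOn g (fun _ => 0) (Ioi 0) := fun t ht => by
    have := hz ht
    simpa [Real.exp_ne_zero] using this
  intro t ht
  have := hz'.of_subset_closure hc (continuousOn_const) Ioi_subset_Ici_self
    (by rw [closure_Ioi])
  exact this ht

theorem eq_of_laplace_eq {f g : ℝ → ℝ} {C D : ℝ} (hf : ContinuousOn f (Ici 0))
    (hg : ContinuousOn g (Ici 0)) (hfb : ∀ t, 0 ≤ t → |f t| ≤ C) (hgb : ∀ t, 0 ≤ t → |g t| ≤ D)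
    (hL : ∀ u, 0 < u → laplace f u = laplace g u) : ∀ t, 0 ≤ t → f t = g t := by
  have hm : ∀ {k : ℝ → ℝ}, ContinuousOn k (Ici 0) →
      AEStronglyMeasurable k (volume.restrict (Ioi 0)) := fun hk =>
    (hk.mono Ioi_subset_Ici_self).aestronglyMeasurable measurableSet_Ioi
  intro t ht
  refine sub_eq_zero.1 (eq_zero_of_laplace_eq_zero (C := C + D) (hf.sub hg) (fun t ht => ?_)
    (fun u hu => ?_) t ht)
  · exact (abs_sub _ _).trans (add_le_add (hfb t ht) (hgb t ht))
  · rw [← sub_eq_zero.2 (hL u hu)]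
    exact laplace_sub (.of_bounded hu (hm hf) fun t ht => hfb t ht.le)
      (.of_bounded hu (hm hg) fun t ht => hgb t ht.le)

/-! ### Caputo equations as Volterra equations -/

theorem fracInt_congr {a t : ℝ} {f g : ℝ → ℝ} (ht : 0 ≤ t) (h : ∀ s, 0 < s → s ≤ t → f s = g s) :
    fracInt a f t = fracInt a g t := by
  unfold fracInt
  congr 1
  refine intervalIntegral.integral_congr_ae (Filter.Eventually.of_forall fun s hs => ?_)
  rw [uIoc_of_le ht] at hs
  rw [h s hs.1 hs.2]

/-- For `b < 1`, applying the integral of order `b` to `D = I^{1-b} g'` gives `I^1 g' = g - g 0` by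
the semigroup law; for `b = 1` this is the fundamental theorem of calculus. -/
theorem eq_add_fracInt {g D : ℝ → ℝ} {b t : ℝ} (hb0 : 0 < b) (hb1 : b ≤ 1) (ht : 0 < t)
    (hac : AbsolutelyContinuousOnInterval g 0 t)
    (hone : b = 1 → ∀ s, 0 < s → HasDerivAt g (D s) s)
    (hlt : b < 1 → ∀ s, 0 < s → D s = fracInt (1 - b) (deriv g) s) :
    g t = g 0 + fracInt b D t := by
  have hftc := hac.integral_deriv_eq_sub
  rcases hb1.eq_or_lt with rfl | hb1
  · rw [fracInt_congr ht.le fun s hs _ => (hone rfl s hs).deriv.symm, fracInt_one, hftc]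
    ring
  · rw [fracInt_congr ht.le fun s hs _ => hlt hb1 s hs,
      fracInt_fracInt hb0 (sub_pos.2 hb1) (by linarith) ht hac.intervalIntegrable_deriv,
      add_sub_cancel, fracInt_one, hftc]
    ring

theorem HasCaputoDeriv.eq_add_fracInt_of_le_one {α : ℝ} {f D : ℝ → ℝ} (hα0 : 0 < α) (hα1 : α ≤ 1)
    (h : HasCaputoDeriv α f D) {t : ℝ} (ht : 0 ≤ t) : f t = f 0 + fracInt α D t := by
  rcases ht.eq_or_lt with rfl | ht
  · rw [fracInt_zero_right, add_zero]
  have hc : ⌈α⌉₊ = 1 := by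
    rw [Nat.ceil_eq_iff one_ne_zero]; simpa using ⟨hα0, hα1⟩
  obtain ⟨-, hac, h1, -, h2⟩ := h
  simp only [hc, Nat.cast_one, tsub_self, iteratedDerivWithin_zero] at hac h1 h2
  exact eq_add_fracInt hα0 hα1 ht (hac t ht) h1 fun hlt s hs => by
    rw [h2 hlt.ne s hs, fracInt]

/-- The first derivative solves an equation of order `α - 1 ≤ 1`; one more integration reaches order
`α`. The vanishing initial slope removes the linear term. -/
theorem HasCaputoDeriv.eq_add_fracInt_of_one_lt {α : ℝ} {f D : ℝ → ℝ} (hα1 : 1 < α) (hα2 : α ≤ 2)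
    (h : HasCaputoDeriv α f D) (hD : ContinuousOn D (Ici 0)) (h0 : HasDerivWithinAt f 0 (Ici 0) 0)
    {t : ℝ} (ht : 0 ≤ t) : f t = f 0 + fracInt α D t := by
  rcases ht.eq_or_lt with rfl | ht
  · rw [fracInt_zero_right, add_zero]
  have hc : ⌈α⌉₊ = 2 := by
    rw [Nat.ceil_eq_iff two_ne_zero]; norm_num; exact ⟨hα1, hα2⟩
  obtain ⟨hcd, hac, h1, -, h2⟩ := h
  simp only [hc, Nat.cast_ofNat, Nat.add_one_sub_one, iteratedDerivWithin_one, Nat.cast_one]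
    at hcd hac h1 h2
  have hDi : IntervalIntegrable D volume 0 t :=
    (hD.mono (by rw [uIcc_of_le ht.le]; exact Icc_subset_Ici_self)).intervalIntegrable
  have hd0 : derivWithin f (Ici 0) 0 = 0 := h0.derivWithin (uniqueDiffOn_Ici 0 0 self_mem_Ici)
  have key : ∀ s, 0 < s → derivWithin f (Ici 0) s = fracInt (α - 1) D s := fun s hs => by
    have := eq_add_fracInt (g := derivWithin f (Ici 0)) (D := D) (b := α - 1) (by linarith)
      (by linarith) hs (hac s hs) (fun hb r hr => h1 (by linarith) r hr) (fun hb r hr => ?_)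
    · rw [this, hd0, zero_add]
    · rw [h2 (by linarith) r hr, fracInt, show 1 - (α - 1) = 2 - α by ring]
  have hfd : ∀ s, 0 < s → HasDerivAt f (derivWithin f (Ici 0) s) s := fun s hs => by
    have := (hcd.differentiableOn one_ne_zero s hs.le).hasDerivWithinAt
    exact this.hasDerivAt (Ici_mem_nhds hs)
  have hftc : ∫ s in (0 : ℝ)..t, derivWithin f (Ici 0) s = f t - f 0 := by
    refine intervalIntegral.integral_eq_sub_of_hasDerivAt_of_le ht.le
      (hcd.continuousOn.mono Icc_subset_Ici_self) (fun s hs => hfd s hs.1) ?_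
    exact (hac t ht).continuousOn.intervalIntegrable
  have : f t = f 0 + fracInt 1 (fracInt (α - 1) D) t := by
    rw [← fracInt_congr ht.le fun s hs _ => key s hs, fracInt_one, hftc]; ring
  rw [this, fracInt_fracInt one_pos (by linarith) (by linarith) ht hDi, add_sub_cancel]

theorem fracInt_const {a t : ℝ} (ha : 0 < a) (c : ℝ) :
    fracInt a (fun _ => c) t = c * t ^ a / Real.Gamma (a + 1) := by
  have h : ∫ s in (0 : ℝ)..t, (t - s) ^ (a - 1) = t ^ a / a := by
    rw [intervalIntegral.integral_comp_sub_left (fun x => x ^ (a - 1)), sub_self, sub_zero,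
      integral_rpow (Or.inl (by linarith)), sub_add_cancel, Real.zero_rpow ha.ne', sub_zero]
  have := Real.Gamma_pos_of_pos ha
  rw [fracInt, intervalIntegral.integral_const_mul, h, Real.Gamma_add_one ha.ne']
  field_simp

theorem intervalIntegrable_sub_rpow {a t : ℝ} (ha : 0 < a) :
    IntervalIntegrable (fun s => (t - s) ^ (a - 1)) volume 0 t := by
  have h := (intervalIntegral.intervalIntegrable_rpow' (a := 0) (b := t)
    (show -1 < a - 1 by linarith)).comp_sub_left t
  simpa using h.symm

theorem abs_fracInt_le {a t C : ℝ} {g : ℝ → ℝ} (ha : 0 < a) (ht : 0 ≤ t)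
    (hg : ∀ s, 0 < s → s ≤ t → |g s| ≤ C) : |fracInt a g t| ≤ C * t ^ a / Real.Gamma (a + 1) := by
  rw [← fracInt_const ha, fracInt, fracInt, abs_mul,
    abs_of_pos (one_div_pos.2 (Real.Gamma_pos_of_pos ha))]
  refine mul_le_mul_of_nonneg_left ?_ (one_div_pos.2 (Real.Gamma_pos_of_pos ha)).le
  rw [← Real.norm_eq_abs]
  refine intervalIntegral.norm_integral_le_of_norm_le ht (Filter.Eventually.of_forall
    fun s hs => ?_) ((intervalIntegrable_sub_rpow ha).const_mul C)
  rw [norm_mul, Real.norm_eq_abs, Real.norm_of_nonneg (Real.rpow_nonneg (sub_nonneg.2 hs.2) _)]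
  exact mul_le_mul_of_nonneg_right (hg s hs.1 hs.2) (Real.rpow_nonneg (sub_nonneg.2 hs.2) _)

theorem tendsto_fracInt {a t C : ℝ} {g : ℕ → ℝ → ℝ} {g' : ℝ → ℝ} (ha : 0 < a) (ht : 0 ≤ t)
    (hm : ∀ n, ContinuousOn (g n) (Ici 0))
    (hb : ∀ n s, 0 ≤ s → |g n s| ≤ C)
    (hl : ∀ s, 0 ≤ s → Filter.Tendsto (fun n => g n s) Filter.atTop (nhds (g' s))) :
    Filter.Tendsto (fun n => fracInt a (g n) t) Filter.atTop (nhds (fracInt a g' t)) := by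
  refine Filter.Tendsto.const_mul _ ?_
  refine intervalIntegral.tendsto_integral_filter_of_dominated_convergence
    (fun s => C * (t - s) ^ (a - 1)) (Filter.Eventually.of_forall fun n => ?_)
    (Filter.Eventually.of_forall fun n => Filter.Eventually.of_forall fun s hs => ?_)
    ((intervalIntegrable_sub_rpow ha).const_mul C) (Filter.Eventually.of_forall fun s hs => ?_)
  · refine AEStronglyMeasurable.mul (((hm n).mono ?_).aestronglyMeasurable measurableSet_uIoc)
      (by fun_prop : Measurable fun s => (t - s) ^ (a - 1)).aestronglyMeasurable
    rw [uIoc_of_le ht]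
    exact Ioc_subset_Ioi_self.trans Ioi_subset_Ici_self
  · rw [uIoc_of_le ht] at hs
    rw [norm_mul, Real.norm_eq_abs, Real.norm_of_nonneg (Real.rpow_nonneg (sub_nonneg.2 hs.2) _)]
    exact mul_le_mul_of_nonneg_right (hb n s hs.1.le) (Real.rpow_nonneg (sub_nonneg.2 hs.2) _)
  · rw [uIoc_of_le ht] at hs
    exact (hl s hs.1.le).mul_const _

/-! ### The diffusion equation beyond compactly supported test functions -/

open Filter Topology

theorem hasCompactSupport_iteratedDeriv_two {φ : ℝ → ℝ} (h : HasCompactSupport φ) :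
    HasCompactSupport (iteratedDeriv 2 φ) := by
  rw [iteratedDeriv_succ, iteratedDeriv_one]
  exact h.deriv.deriv

theorem contDiff_iteratedDeriv {φ : ℝ → ℝ} (h : ContDiff ℝ ((⊤ : ℕ∞) : WithTop ℕ∞) φ) (n : ℕ) :
    ContDiff ℝ ((⊤ : ℕ∞) : WithTop ℕ∞) (iteratedDeriv n φ) := by
  rw [iteratedDeriv_eq_iterate]
  exact h.iterate_deriv n

namespace IsFundamentalSolution

variable {α : ℝ} {q : ℝ → Measure ℝ}

theorem continuousOn_integral_test (hq : IsFundamentalSolution α q) {φ : ℝ → ℝ}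
    (hφ : ContDiff ℝ ((⊤ : ℕ∞) : WithTop ℕ∞) φ) (hs : HasCompactSupport φ) :
    ContinuousOn (fun t => ∫ x, φ x ∂(q t)) (Ici 0) :=
  (hq.equation φ hφ hs).contDiffOn.continuousOn

theorem integral_zero (hq : IsFundamentalSolution α q) (φ : ℝ → ℝ) :
    ∫ x, φ x ∂(q 0) = φ 0 := by
  rw [hq.initial, integral_dirac]

theorem integral_test_eq (hq : IsFundamentalSolution α q) (hα0 : 0 < α) (hα2 : α ≤ 2)
    {φ : ℝ → ℝ} (hφ : ContDiff ℝ ((⊤ : ℕ∞) : WithTop ℕ∞) φ) (hs : HasCompactSupport φ)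
    {t : ℝ} (ht : 0 ≤ t) :
    ∫ x, φ x ∂(q t) = φ 0 + fracInt α (fun s => ∫ x, iteratedDeriv 2 φ x ∂(q s)) t := by
  rw [← hq.integral_zero φ]
  rcases le_or_gt α 1 with h1 | h1
  · exact (hq.equation φ hφ hs).eq_add_fracInt_of_le_one hα0 h1 ht
  · exact (hq.equation φ hφ hs).eq_add_fracInt_of_one_lt h1 hα2
      (hq.continuousOn_integral_test (contDiff_iteratedDeriv hφ 2)
        (hasCompactSupport_iteratedDeriv_two hs)) (hq.initial_deriv h1 φ hφ hs) ht

end IsFundamentalSolution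

/-- A smooth cutoff function, equal to `1` on `[-1, 1]` and to `0` outside `(-2, 2)`. -/
def cutoff : ContDiffBump (0 : ℝ) := ⟨1, 2, one_pos, one_lt_two⟩

theorem contDiff_cutoff : ContDiff ℝ ((⊤ : ℕ∞) : WithTop ℕ∞) cutoff := cutoff.contDiff

theorem cutoff_eq_one {x : ℝ} (h : |x| ≤ 1) : cutoff x = 1 :=
  cutoff.one_of_mem_closedBall (by simpa [cutoff] using h)

theorem hasCompactSupport_cutoff : HasCompactSupport cutoff := cutoff.hasCompactSupport

theorem hasCompactSupport_comp_mul {φ : ℝ → ℝ} (h : HasCompactSupport φ) {c : ℝ} (hc : c ≠ 0) :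
    HasCompactSupport fun x => φ (c * x) :=
  h.comp_homeomorph (Homeomorph.mulLeft₀ c hc)

/-- The quadratic bound lets second moments control the truncation error. -/
theorem one_sub_cutoff_le (x : ℝ) : |1 - cutoff x| ≤ x ^ 2 := by
  rcases le_or_gt |x| 1 with h | h
  · rw [cutoff_eq_one h]; simp; positivity
  · rw [abs_of_nonneg (sub_nonneg.2 cutoff.le_one)]
    have h1 : 0 ≤ cutoff x := cutoff.nonneg
    nlinarith [sq_abs x]

theorem tendsto_mul_inv_succ (x : ℝ) :
    Tendsto (fun n : ℕ => ((n : ℝ) + 1)⁻¹ * x) atTop (𝓝 0) := by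
  have h : Tendsto (fun n : ℕ => (n : ℝ) + 1) atTop atTop :=
    tendsto_atTop_add_const_right _ _ tendsto_natCast_atTop_atTop
  simpa using h.inv_tendsto_atTop.mul_const x

/-- Equality on a neighbourhood, not just at `x`, transfers to derivatives. -/
theorem eventually_cutoff_eq_one (x : ℝ) :
    ∀ᶠ n : ℕ in atTop, ∀ᶠ y in 𝓝 x, cutoff (((n : ℝ) + 1)⁻¹ * y) = 1 := by
  have h := (tendsto_mul_inv_succ x).eventually (Metric.ball_mem_nhds 0 one_pos)
  filter_upwards [h] with n hn
  have hc : Continuous fun y : ℝ => ((n : ℝ) + 1)⁻¹ * y := by fun_prop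
  filter_upwards [hc.continuousAt.eventually (Metric.isOpen_ball.mem_nhds hn)] with y hy
  refine cutoff_eq_one ?_
  simpa using (Metric.mem_ball.1 hy).le

namespace IsFundamentalSolution

variable {α : ℝ} {q : ℝ → Measure ℝ}

/-- The truncations `n² η(x/n)` of `x²` vanish at `0`, and their second derivatives `η''(x/n)` are
bounded by one constant `B`. The Volterra equation bounds their expectations by `B t^α / Γ(α + 1)`,
and Fatou passes to `x²`. -/
theorem exists_sq_moment_bound (hq : IsFundamentalSolution α q) (hα0 : 0 < α) (hα2 : α ≤ 2) :
    ∃ C, 0 ≤ C ∧ ∀ t, 0 ≤ t → Integrable (fun x => x ^ 2) (q t) ∧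
      ∫ x, x ^ 2 ∂(q t) ≤ C * t ^ α := by
  set η : ℝ → ℝ := fun x => x ^ 2 * cutoff x with hη
  have hηs : ContDiff ℝ ((⊤ : ℕ∞) : WithTop ℕ∞) η := (contDiff_id.pow 2).mul contDiff_cutoff
  have hηc : HasCompactSupport η := hasCompactSupport_cutoff.mul_left
  have hη0 : ∀ x, 0 ≤ η x := fun x => mul_nonneg (sq_nonneg _) cutoff.nonneg
  obtain ⟨B, hB⟩ := (hasCompactSupport_iteratedDeriv_two hηc).exists_bound_of_continuous
    (contDiff_iteratedDeriv hηs 2).continuous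
  have hB0 : 0 ≤ B := (norm_nonneg _).trans (hB 0)
  have hG := Real.Gamma_pos_of_pos (show 0 < α + 1 by linarith)
  refine ⟨B / Real.Gamma (α + 1), by positivity, fun t ht => ?_⟩
  have hK : 0 ≤ B / Real.Gamma (α + 1) * t ^ α :=
    mul_nonneg (by positivity) (Real.rpow_nonneg ht _)
  have hbound : ∀ n : ℕ, ∫⁻ x, ENNReal.ofReal (((n : ℝ) + 1) ^ 2 * η (((n : ℝ) + 1)⁻¹ * x)) ∂(q t)
      ≤ ENNReal.ofReal (B / Real.Gamma (α + 1) * t ^ α) := by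
    intro n
    have hn : (0 : ℝ) < (n : ℝ) + 1 := by positivity
    set φ : ℝ → ℝ := fun x => ((n : ℝ) + 1) ^ 2 * η (((n : ℝ) + 1)⁻¹ * x) with hφ
    have hηn : ContDiff ℝ ((⊤ : ℕ∞) : WithTop ℕ∞) fun x => η (((n : ℝ) + 1)⁻¹ * x) :=
      hηs.comp (contDiff_const.mul contDiff_id)
    have hφs : ContDiff ℝ ((⊤ : ℕ∞) : WithTop ℕ∞) φ := contDiff_const.mul hηn
    have hφc : HasCompactSupport φ := (hasCompactSupport_comp_mul hηc (by positivity)).mul_left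
    have hφ2 : ∀ x, |iteratedDeriv 2 φ x| ≤ B := by
      intro x
      have h2 : ContDiff ℝ ((2 : ℕ) : WithTop ℕ∞) η := contDiff_infty.1 hηs 2
      rw [hφ, iteratedDeriv_const_mul_field, iteratedDeriv_comp_const_mul h2, ← mul_assoc,
        ← mul_pow, mul_inv_cancel₀ hn.ne', one_pow, one_mul]
      exact hB _
    have := hq.isProbabilityMeasure t ht
    rw [← ofReal_integral_eq_lintegral_ofReal
      (hφs.continuous.integrable_of_hasCompactSupport hφc)
      (Eventually.of_forall fun x => mul_nonneg (by positivity) (hη0 _))]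
    refine ENNReal.ofReal_le_ofReal ?_
    rw [hq.integral_test_eq hα0 hα2 hφs hφc ht]
    have h0 : φ 0 = 0 := by simp [hφ, hη]
    rw [h0, zero_add, div_mul_eq_mul_div]
    refine (le_abs_self _).trans (abs_fracInt_le hα0 ht fun s hs _ => ?_)
    have := hq.isProbabilityMeasure s hs.le
    rw [← Real.norm_eq_abs]
    refine (norm_integral_le_of_norm_le_const (C := B) (Eventually.of_forall hφ2)).trans ?_
    simp
  have hlim : ∀ x : ℝ, Tendsto (fun n : ℕ => ENNReal.ofReal
      (((n : ℝ) + 1) ^ 2 * η (((n : ℝ) + 1)⁻¹ * x))) atTop (𝓝 (ENNReal.ofReal (x ^ 2))) := by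
    intro x
    refine tendsto_const_nhds.congr' ?_
    filter_upwards [eventually_cutoff_eq_one x] with n hn
    have hn0 : ((n : ℝ) + 1) ≠ 0 := by positivity
    rw [hη]
    simp only
    rw [hn.self_of_nhds, mul_one]
    congr 1
    field_simp
  have hle : ∫⁻ x, ENNReal.ofReal (x ^ 2) ∂(q t)
      ≤ ENNReal.ofReal (B / Real.Gamma (α + 1) * t ^ α) := by
    have hc := hηs.continuous
    have := lintegral_liminf_le (u := atTop) (μ := q t) (f := fun (n : ℕ) x => ENNReal.ofReal
      (((n : ℝ) + 1) ^ 2 * η (((n : ℝ) + 1)⁻¹ * x))) (fun n => by fun_prop)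
    simp only [(hlim _).liminf_eq] at this
    refine this.trans ?_
    exact liminf_le_of_frequently_le' (Frequently.of_forall hbound)
  have hint : Integrable (fun x : ℝ => x ^ 2) (q t) := by
    refine ⟨by fun_prop, ?_⟩
    rw [hasFiniteIntegral_iff_ofReal (Eventually.of_forall fun x => sq_nonneg x)]
    exact hle.trans_lt ENNReal.ofReal_lt_top
  refine ⟨hint, ?_⟩
  rw [← ofReal_integral_eq_lintegral_ofReal hint (Eventually.of_forall fun x => sq_nonneg x)]
    at hle
  exact (ENNReal.ofReal_le_ofReal_iff hK).1 hle

theorem integrable_abs (hq : IsFundamentalSolution α q) (hα0 : 0 < α) (hα2 : α ≤ 2)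
    {t : ℝ} (ht : 0 ≤ t) : Integrable (fun x => |x|) (q t) := by
  obtain ⟨C, -, hC⟩ := hq.exists_sq_moment_bound hα0 hα2
  have := hq.isProbabilityMeasure t ht
  refine ((hC t ht).1.add (integrable_const (1 : ℝ))).mono' (by fun_prop)
    (Eventually.of_forall fun x => ?_)
  simp only [Pi.add_apply, Real.norm_eq_abs, abs_abs]
  nlinarith [sq_abs x, sq_nonneg (|x| - 1)]

theorem abs_iteratedDeriv_two_mul_le {f g : ℝ → ℝ} {x M B : ℝ}
    (hf : ContDiff ℝ ((⊤ : ℕ∞) : WithTop ℕ∞) f) (hg : ContDiff ℝ ((⊤ : ℕ∞) : WithTop ℕ∞) g)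
    (hfM : ∀ i ≤ 2, |iteratedDeriv i f x| ≤ M) (hgB : ∀ i ≤ 2, |iteratedDeriv i g x| ≤ B) :
    |iteratedDeriv 2 (fun y => f y * g y) x| ≤ 4 * (M * B) := by
  have hM : 0 ≤ M := (abs_nonneg _).trans (hfM 0 (by norm_num))
  rw [iteratedDeriv_fun_mul (contDiff_infty.1 hf 2).contDiffAt
    (contDiff_infty.1 hg 2).contDiffAt]
  have key : ∀ i j, i ≤ 2 → j ≤ 2 → |iteratedDeriv i f x * iteratedDeriv j g x| ≤ M * B := by
    intro i j hi hj
    rw [abs_mul]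
    exact mul_le_mul (hfM i hi) (hgB j hj) (abs_nonneg _) hM
  have h0 := abs_le.1 (key 0 2 (by norm_num) le_rfl)
  have h1 := abs_le.1 (key 1 1 (by norm_num) (by norm_num))
  have h2 := abs_le.1 (key 2 0 le_rfl (by norm_num))
  simp only [Finset.sum_range_succ, Finset.sum_range_zero, Nat.choose_zero_right, Nat.choose_self,
    Nat.cast_one, one_mul, zero_add, Nat.sub_zero, Nat.choose_one_right, Nat.cast_ofNat,
    Nat.add_one_sub_one, Nat.sub_self]
  rw [abs_le]
  constructor <;> nlinarith

/-- The equation extends from test functions to smooth functions with bounded derivatives. -/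
theorem integral_eq_of_bounded (hq : IsFundamentalSolution α q) (hα0 : 0 < α) (hα2 : α ≤ 2)
    {ψ : ℝ → ℝ} {M : ℝ} (hψ : ContDiff ℝ ((⊤ : ℕ∞) : WithTop ℕ∞) ψ)
    (hM : ∀ i ≤ 2, ∀ x, |iteratedDeriv i ψ x| ≤ M) :
    ContinuousOn (fun t => ∫ x, ψ x ∂(q t)) (Ici 0) ∧
    ∀ t, 0 ≤ t →
      ∫ x, ψ x ∂(q t) = ψ 0 + fracInt α (fun s => ∫ x, iteratedDeriv 2 ψ x ∂(q s)) t := by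
  have hψM : ∀ x, |ψ x| ≤ M := fun x => by simpa using hM 0 (by norm_num) x
  have hM0 : 0 ≤ M := (abs_nonneg _).trans (hψM 0)
  obtain ⟨C, hC0, hC⟩ := hq.exists_sq_moment_bound hα0 hα2
  set χ : ℕ → ℝ → ℝ := fun n x => cutoff (((n : ℝ) + 1)⁻¹ * x) with hχ
  set φ : ℕ → ℝ → ℝ := fun n x => ψ x * χ n x with hφ
  have hχs : ∀ n, ContDiff ℝ ((⊤ : ℕ∞) : WithTop ℕ∞) (χ n) := fun n =>
    contDiff_cutoff.comp (contDiff_const.mul contDiff_id)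
  have hφs : ∀ n, ContDiff ℝ ((⊤ : ℕ∞) : WithTop ℕ∞) (φ n) := fun n => hψ.mul (hχs n)
  have hφc : ∀ n, HasCompactSupport (φ n) := fun n =>
    (hasCompactSupport_comp_mul hasCompactSupport_cutoff (by positivity)).mul_left
  have hχ1 : ∀ n x, |χ n x| ≤ 1 := fun n x => by
    rw [hχ, abs_of_nonneg cutoff.nonneg]; exact cutoff.le_one
  have hφM : ∀ n x, |φ n x| ≤ M := fun n x => by
    rw [hφ, abs_mul]
    simpa using mul_le_mul (hψM x) (hχ1 n x) (abs_nonneg _) hM0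
  obtain ⟨B1, hB1⟩ := hasCompactSupport_cutoff.deriv.exists_bound_of_continuous
    (by simpa using (contDiff_iteratedDeriv contDiff_cutoff 1).continuous)
  obtain ⟨B2, hB2⟩ := (hasCompactSupport_iteratedDeriv_two
    hasCompactSupport_cutoff).exists_bound_of_continuous
    (contDiff_iteratedDeriv contDiff_cutoff 2).continuous
  have hχB : ∀ n x, ∀ i ≤ 2, |iteratedDeriv i (χ n) x| ≤ 1 + B1 + B2 := by
    intro n x i hi
    have hb1 : 0 ≤ B1 := (norm_nonneg _).trans (hB1 0)
    have hb2 : 0 ≤ B2 := (norm_nonneg _).trans (hB2 0)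
    rw [hχ, iteratedDeriv_comp_const_mul (contDiff_cutoff.of_le (by exact_mod_cast le_top)),
      abs_mul]
    have hc : |((n : ℝ) + 1)⁻¹ ^ i| ≤ 1 := by
      rw [abs_of_nonneg (by positivity)]
      refine pow_le_one₀ (by positivity) (inv_le_one_of_one_le₀ ?_)
      have : (0 : ℝ) ≤ n := n.cast_nonneg
      linarith
    refine (mul_le_of_le_one_left (abs_nonneg _) hc).trans ?_
    interval_cases i
    · have := hχ1 n x
      simp only [iteratedDeriv_zero]
      linarith
    · have := hB1 (((n : ℝ) + 1)⁻¹ * x)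
      rw [Real.norm_eq_abs] at this
      simp only [iteratedDeriv_one]
      linarith
    · have := hB2 (((n : ℝ) + 1)⁻¹ * x)
      rw [Real.norm_eq_abs] at this
      linarith
  have hφ2 : ∀ n x, |iteratedDeriv 2 (φ n) x| ≤ 4 * (M * (1 + B1 + B2)) := fun n x =>
    abs_iteratedDeriv_two_mul_le hψ (hχs n) (fun i hi => hM i hi x) (hχB n x)
  -- The error is `O(t^α / n²)`, hence locally uniform in `t`, so continuity survives the limit.
  have hlim0 : ∀ t, 0 ≤ t → ∀ n : ℕ,
      |∫ x, φ n x ∂(q t) - ∫ x, ψ x ∂(q t)| ≤ M * (C * t ^ α) * (((n : ℝ) + 1)⁻¹) ^ 2 := by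
    intro t ht n
    have := hq.isProbabilityMeasure t ht
    rw [← integral_sub ((hφs n).continuous.integrable_of_hasCompactSupport (hφc n))
      (Integrable.of_bound (C := M) hψ.continuous.aestronglyMeasurable
        (Eventually.of_forall hψM)), ← Real.norm_eq_abs]
    refine (norm_integral_le_of_norm_le ((hC t ht).1.const_mul (M * (((n : ℝ) + 1)⁻¹) ^ 2))
      (Eventually.of_forall fun x => ?_)).trans ?_
    · rw [Real.norm_eq_abs, show φ n x - ψ x = ψ x * -(1 - χ n x) by simp only [hφ]; ring,
        abs_mul, abs_neg, mul_assoc, ← mul_pow]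
      exact mul_le_mul (hψM x) (one_sub_cutoff_le _) (abs_nonneg _) hM0
    · rw [integral_const_mul]
      have := mul_le_mul_of_nonneg_left (hC t ht).2
        (show 0 ≤ M * (((n : ℝ) + 1)⁻¹) ^ 2 by positivity)
      linarith
  have hinv : Tendsto (fun n : ℕ => (((n : ℝ) + 1)⁻¹) ^ 2) atTop (𝓝 0) := by
    simpa using (tendsto_mul_inv_succ 1).pow 2
  have hcont : ContinuousOn (fun t => ∫ x, ψ x ∂(q t)) (Ici 0) := by
    refine TendstoLocallyUniformlyOn.continuousOn (F := fun n t => ∫ x, φ n x ∂(q t))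
      (p := atTop) ?_ (Frequently.of_forall fun n =>
        hq.continuousOn_integral_test (hφs n) (hφc n))
    rw [Metric.tendstoLocallyUniformlyOn_iff]
    intro ε hε t ht
    refine ⟨Iio (t + 1) ∩ Ici 0, inter_mem (mem_nhdsWithin_of_mem_nhds
      (Iio_mem_nhds (by linarith))) self_mem_nhdsWithin, ?_⟩
    have h1 : Tendsto (fun n : ℕ => M * (C * (t + 1) ^ α) * (((n : ℝ) + 1)⁻¹) ^ 2) atTop
        (𝓝 0) := by simpa using hinv.const_mul (M * (C * (t + 1) ^ α))
    filter_upwards [h1.eventually (gt_mem_nhds hε)] with n hn s hs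
    rw [Real.dist_eq, abs_sub_comm]
    refine (hlim0 s hs.2 n).trans_lt (lt_of_le_of_lt ?_ hn)
    have : s ^ α ≤ (t + 1) ^ α := Real.rpow_le_rpow hs.2 (le_of_lt hs.1) hα0.le
    gcongr
  refine ⟨hcont, fun t ht => ?_⟩
  have hl : Tendsto (fun n => ∫ x, φ n x ∂(q t)) atTop (𝓝 (∫ x, ψ x ∂(q t))) := by
    rw [tendsto_iff_dist_tendsto_zero]
    refine squeeze_zero (fun _ => dist_nonneg) (hlim0 t ht) ?_
    simpa using hinv.const_mul (M * (C * t ^ α))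
  have hφ0 : ∀ n, φ n 0 = ψ 0 := fun n => by
    simp only [hφ, hχ, mul_zero]
    rw [cutoff_eq_one (by simp), mul_one]
  -- Second derivatives need no rate: they are uniformly bounded and eventually equal at each point,
  -- so dominated convergence suffices, first in `x`, then in time.
  have hr : Tendsto (fun n => ψ 0 + fracInt α (fun s => ∫ x, iteratedDeriv 2 (φ n) x ∂(q s)) t)
      atTop (𝓝 (ψ 0 + fracInt α (fun s => ∫ x, iteratedDeriv 2 ψ x ∂(q s)) t)) := by
    refine (tendsto_fracInt (C := 4 * (M * (1 + B1 + B2))) hα0 ht (fun n => ?_) (fun n s hs => ?_)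
      (fun s hs => ?_)).const_add _
    · exact hq.continuousOn_integral_test (contDiff_iteratedDeriv (hφs n) 2)
        (hasCompactSupport_iteratedDeriv_two (hφc n))
    · have := hq.isProbabilityMeasure s hs
      rw [← Real.norm_eq_abs]
      refine (norm_integral_le_of_norm_le_const (Eventually.of_forall (hφ2 n))).trans ?_
      simp
    · have := hq.isProbabilityMeasure s hs
      refine tendsto_integral_of_dominated_convergence (fun _ => 4 * (M * (1 + B1 + B2)))
        (fun n => (contDiff_iteratedDeriv (hφs n) 2).continuous.aestronglyMeasurable)
        (integrable_const _) (fun n => Eventually.of_forall (hφ2 n))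
        (Eventually.of_forall fun x => ?_)
      refine tendsto_const_nhds.congr' ?_
      filter_upwards [eventually_cutoff_eq_one x] with n hn
      refine EventuallyEq.iteratedDeriv_eq 2 ?_
      filter_upwards [hn] with y hy
      simp only [hφ, hχ, hy, mul_one]
  refine tendsto_nhds_unique hl (hr.congr fun n => ?_)
  rw [hq.integral_test_eq hα0 hα2 (hφs n) (hφc n) ht, hφ0]

/-! ### Fourier–Laplace transform of the fundamental solution -/

/-- The Laplace transform in time of the expectation of a bounded eigenfunction of `d²/dx²`. -/
theorem laplace_integral_eigen (hq : IsFundamentalSolution α q) (hα0 : 0 < α) (hα2 : α ≤ 2)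
    {ψ : ℝ → ℝ} {M ξ u : ℝ} (hψ : ContDiff ℝ ((⊤ : ℕ∞) : WithTop ℕ∞) ψ)
    (hM : ∀ i ≤ 2, ∀ x, |iteratedDeriv i ψ x| ≤ M)
    (heig : ∀ x, iteratedDeriv 2 ψ x = -ξ ^ 2 * ψ x) (hu : 0 < u) :
    u * laplace (fun t => ∫ x, ψ x ∂(q t)) u = ψ 0 / (1 + ξ ^ 2 * u ^ (-α)) := by
  obtain ⟨hc, he⟩ := hq.integral_eq_of_bounded hα0 hα2 hψ hM
  have hψM : ∀ x, |ψ x| ≤ M := fun x => by simpa using hM 0 (by norm_num) x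
  have hb : ∀ t, 0 < t → |∫ x, ψ x ∂(q t)| ≤ M := fun t ht => by
    have := hq.isProbabilityMeasure t ht.le
    rw [← Real.norm_eq_abs]
    refine (norm_integral_le_of_norm_le_const (Eventually.of_forall hψM)).trans ?_
    simp
  have hmeas : AEStronglyMeasurable (fun t => ∫ x, ψ x ∂(q t)) (volume.restrict (Ioi 0)) :=
    (hc.mono Ioi_subset_Ici_self).aestronglyMeasurable measurableSet_Ioi
  have hi : LaplaceIntegrable (fun t => ∫ x, ψ x ∂(q t)) u := .of_bounded hu hmeas hb
  -- Transforming the Volterra equation gives the scalar equation `L = ψ 0 / u - ξ² u^{-α} L`.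
  have h := laplace_congr (fun t ht => he t ht.le) u
  have h2 : (fun s => ∫ x, iteratedDeriv 2 ψ x ∂(q s))
      = fun s => -ξ ^ 2 * ∫ x, ψ x ∂(q s) := by
    ext s
    simp only [heig, integral_const_mul]
  rw [h2, laplace_add (.of_bounded hu (by fun_prop) (C := |ψ 0|) fun _ _ => le_rfl)
    ((hi.const_mul _).fracInt hα0 hu), laplace_const hu, laplace_fracInt hα0 hu (hi.const_mul _),
    laplace_const_mul] at h
  have hpos : 0 < 1 + ξ ^ 2 * u ^ (-α) := by
    have := Real.rpow_pos_of_pos hu (-α)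
    positivity
  rw [eq_div_iff hpos.ne']
  set L := laplace (fun t => ∫ x, ψ x ∂(q t)) u
  have h3 : u * L = u * (ψ 0 / u + u ^ (-α) * (-ξ ^ 2 * L)) := by rw [← h]
  rw [mul_add, mul_div_cancel₀ _ hu.ne'] at h3
  linarith

end IsFundamentalSolution

namespace IsFundamentalSolution

variable {α : ℝ} {q : ℝ → Measure ℝ}

theorem abs_integral_le (hq : IsFundamentalSolution α q) {ψ : ℝ → ℝ} {M t : ℝ} (ht : 0 ≤ t)
    (hM : ∀ x, |ψ x| ≤ M) : |∫ x, ψ x ∂(q t)| ≤ M := by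
  have := hq.isProbabilityMeasure t ht
  rw [← Real.norm_eq_abs]
  refine (norm_integral_le_of_norm_le_const (Eventually.of_forall hM)).trans ?_
  simp

theorem integral_trig (hq : IsFundamentalSolution α q) (hα0 : 0 < α) (hα2 : α ≤ 2)
    {s : ℝ → ℝ} (hs : ContDiff ℝ ((⊤ : ℕ∞) : WithTop ℕ∞) s) (h0 : ∀ x, |s x| ≤ 1)
    (h1 : ∀ x, |deriv s x| ≤ 1) (h2 : ∀ x, iteratedDeriv 2 s x = -s x) (ξ : ℝ) :
    ContinuousOn (fun t => ∫ x, s (ξ * x) ∂(q t)) (Ici 0) ∧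
    ∀ u, 0 < u → u * laplace (fun t => ∫ x, s (ξ * x) ∂(q t)) u
      = s 0 / (1 + ξ ^ 2 * u ^ (-α)) := by
  have hsξ : ContDiff ℝ ((⊤ : ℕ∞) : WithTop ℕ∞) fun x => s (ξ * x) :=
    hs.comp (contDiff_const.mul contDiff_id)
  have hM : ∀ i ≤ 2, ∀ x, |iteratedDeriv i (fun x => s (ξ * x)) x| ≤ 1 + |ξ| + |ξ| ^ 2 := by
    intro i hi x
    have hξ := abs_nonneg ξ
    have hb : ∀ y, |iteratedDeriv i s y| ≤ 1 := by
      intro y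
      interval_cases i
      · simpa using h0 y
      · simpa using h1 y
      · simpa [h2] using h0 y
    rw [iteratedDeriv_comp_const_mul (contDiff_infty.1 hs i), abs_mul, abs_pow]
    refine (mul_le_of_le_one_right (by positivity) (hb _)).trans ?_
    interval_cases i <;> nlinarith [sq_nonneg |ξ|]
  refine ⟨(hq.integral_eq_of_bounded hα0 hα2 hsξ hM).1, fun u hu => ?_⟩
  rw [hq.laplace_integral_eigen hα0 hα2 hsξ hM (ξ := ξ) (fun x => ?_) hu, mul_zero]
  rw [iteratedDeriv_comp_const_mul (contDiff_infty.1 hs 2)]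
  simp only [h2]
  ring

theorem integral_cos_mul (hq : IsFundamentalSolution α q) (hα0 : 0 < α) (hα2 : α ≤ 2) (ξ : ℝ) :
    ContinuousOn (fun t => ∫ x, Real.cos (ξ * x) ∂(q t)) (Ici 0) ∧
    ∀ u, 0 < u → u * laplace (fun t => ∫ x, Real.cos (ξ * x) ∂(q t)) u
      = 1 / (1 + ξ ^ 2 * u ^ (-α)) := by
  simpa using hq.integral_trig hα0 hα2 Real.contDiff_cos Real.abs_cos_le_one
    (fun x => by simpa using Real.abs_sin_le_one x)
    (fun x => by simp [iteratedDeriv_succ]) ξ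

/-- Since `sin 0 = 0`, the Laplace transform vanishes; thus `q t` is symmetric. -/
theorem integral_sin_mul (hq : IsFundamentalSolution α q) (hα0 : 0 < α) (hα2 : α ≤ 2) (ξ : ℝ)
    {t : ℝ} (ht : 0 ≤ t) : ∫ x, Real.sin (ξ * x) ∂(q t) = 0 := by
  obtain ⟨hc, hL⟩ := hq.integral_trig hα0 hα2 Real.contDiff_sin Real.abs_sin_le_one
    (fun x => by simpa using Real.abs_cos_le_one x)
    (fun x => by simp [iteratedDeriv_succ]) ξ
  refine eq_zero_of_laplace_eq_zero hc
    (fun t ht => hq.abs_integral_le ht fun x => Real.abs_sin_le_one _) (fun u hu => ?_) t ht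
  have := hL u hu
  rw [Real.sin_zero, zero_div] at this
  exact (mul_eq_zero.1 this).resolve_left hu.ne'

/-- The transform depends on `ξ` and `u` only through `ξ² u^{-2ν}`, so rescaling time by `t` amounts
to rescaling `ξ` by `t^ν`. The two functions of `s` agree everywhere, in particular at `s = 1`. -/
theorem integral_cos_scale {ν : ℝ} (hq : IsFundamentalSolution (2 * ν) q) (hν0 : 0 < ν)
    (hν1 : ν ≤ 1) (ξ : ℝ) {t : ℝ} (ht : 0 ≤ t) :
    ∫ x, Real.cos (ξ * x) ∂(q t) = ∫ x, Real.cos (ξ * t ^ ν * x) ∂(q 1) := by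
  rcases ht.eq_or_lt with rfl | ht
  · have := hq.isProbabilityMeasure 1 zero_le_one
    rw [hq.integral_zero, Real.zero_rpow hν0.ne']
    simp
  have hα0 : 0 < 2 * ν := by linarith
  have hα2 : 2 * ν ≤ 2 := by linarith
  obtain ⟨hc, hL⟩ := hq.integral_cos_mul hα0 hα2 ξ
  obtain ⟨hc', hL'⟩ := hq.integral_cos_mul hα0 hα2 (ξ * t ^ ν)
  have hct : ContinuousOn (fun s => ∫ x, Real.cos (ξ * x) ∂(q (t * s))) (Ici 0) :=
    hc.comp (f := fun s => t * s) (by fun_prop) fun s hs => mul_nonneg ht.le hs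
  have := eq_of_laplace_eq (C := 1) (D := 1) hct hc'
    (fun s hs => hq.abs_integral_le (mul_nonneg ht.le hs) fun x => Real.abs_cos_le_one _)
    (fun s hs => hq.abs_integral_le hs fun x => Real.abs_cos_le_one _) (fun u hu => ?_) 1
    zero_le_one
  · simpa using this
  · rw [laplace_comp_mul_left (fun s => ∫ x, Real.cos (ξ * x) ∂(q s)) ht]
    have h1 := hL (u / t) (div_pos hu ht)
    have h2 := hL' u hu
    have h3 : (ξ * t ^ ν) ^ 2 * u ^ (-(2 * ν)) = ξ ^ 2 * (u / t) ^ (-(2 * ν)) := by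
      rw [Real.div_rpow hu.le ht.le, Real.rpow_neg ht.le, div_inv_eq_mul, mul_pow,
        mul_comm 2 ν, Real.rpow_mul ht.le, Real.rpow_two]
      ring
    rw [h3, ← h1] at h2
    refine mul_left_cancel₀ hu.ne' (Eq.trans ?_ h2.symm)
    field_simp

end IsFundamentalSolution

/-! ### Exponential and two-sided exponential laws -/

theorem charFun_eq_cos_add_sin (m : Measure ℝ) [IsFiniteMeasure m] (ξ : ℝ) :
    charFun m ξ = ((∫ x, Real.cos (ξ * x) ∂m : ℝ) : ℂ)
      + ((∫ x, Real.sin (ξ * x) ∂m : ℝ) : ℂ) * Complex.I := by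
  have hc : Integrable (fun x => Real.cos (ξ * x)) m :=
    .of_bound (C := 1) (by fun_prop) (Eventually.of_forall fun x => Real.abs_cos_le_one _)
  have hs : Integrable (fun x => Real.sin (ξ * x)) m :=
    .of_bound (C := 1) (by fun_prop) (Eventually.of_forall fun x => Real.abs_sin_le_one _)
  rw [charFun_apply_real, ← integral_complex_ofReal, ← integral_complex_ofReal, ← integral_mul_const,
    ← integral_add hc.ofReal (hs.ofReal.mul_const _)]
  refine integral_congr_ae (Eventually.of_forall fun x => ?_)
  simp only
  rw [← Complex.ofReal_mul, Complex.exp_mul_I]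
  simp

/-- The exponential law of rate `u`. -/
def expLaw (u : ℝ) : Measure ℝ :=
  (volume.restrict (Ioi 0)).withDensity fun t => ENNReal.ofReal (u * Real.exp (-(u * t)))

theorem isFiniteMeasure_expLaw {u : ℝ} (hu : 0 < u) : IsFiniteMeasure (expLaw u) := by
  have h : LaplaceIntegrable (fun _ => u) u :=
    .of_bounded hu (by fun_prop) (C := |u|) fun _ _ => le_rfl
  refine isFiniteMeasure_withDensity_ofReal (Integrable.hasFiniteIntegral ?_)
  have h' : Integrable (fun t => Real.exp (-(u * t)) * u) (volume.restrict (Ioi 0)) := h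
  exact h'.congr (Eventually.of_forall fun t => mul_comm _ _)

theorem integral_expLaw {u : ℝ} (hu : 0 < u) (g : ℝ → ℝ) :
    ∫ t, g t ∂(expLaw u) = u * laplace g u := by
  rw [expLaw, integral_withDensity_eq_integral_toReal_smul (by fun_prop)
    (Eventually.of_forall fun _ => ENNReal.ofReal_lt_top), laplace, ← integral_const_mul]
  refine integral_congr_ae (Eventually.of_forall fun t => ?_)
  simp only
  rw [ENNReal.toReal_ofReal (by positivity), smul_eq_mul, mul_assoc]

theorem ae_expLaw_pos (u : ℝ) : ∀ᵐ t ∂(expLaw u), 0 < t :=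
  (withDensity_absolutelyContinuous _ _).ae_le (ae_restrict_mem measurableSet_Ioi)

/-- The two-sided exponential (Laplace) law of rate `a`. -/
def laplaceLaw (a : ℝ) : Measure ℝ :=
  volume.withDensity fun x => ENNReal.ofReal (a / 2 * Real.exp (-(a * |x|)))

theorem integral_laplaceLaw {a : ℝ} (ha : 0 < a) (g : ℝ → ℝ) :
    ∫ x, g x ∂(laplaceLaw a) = ∫ x, a / 2 * Real.exp (-(a * |x|)) * g x := by
  rw [laplaceLaw, integral_withDensity_eq_integral_toReal_smul (by fun_prop)
    (Eventually.of_forall fun _ => ENNReal.ofReal_lt_top)]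
  refine integral_congr_ae (Eventually.of_forall fun t => ?_)
  simp only
  rw [ENNReal.toReal_ofReal (by positivity), smul_eq_mul]

theorem integral_abs_laplaceLaw {a : ℝ} (ha : 0 < a) (g : ℝ → ℝ) :
    ∫ x, g |x| ∂(laplaceLaw a) = a * laplace g a := by
  rw [integral_laplaceLaw ha,
    integral_comp_abs (f := fun x => a / 2 * Real.exp (-(a * x)) * g x), laplace]
  simp only [mul_assoc]
  rw [integral_const_mul]
  ring

theorem isFiniteMeasure_laplaceLaw {a : ℝ} (ha : 0 < a) : IsFiniteMeasure (laplaceLaw a) := by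
  refine isFiniteMeasure_withDensity_ofReal (Integrable.hasFiniteIntegral ?_)
  by_contra hc
  have h := integral_comp_abs (f := fun x => a / 2 * Real.exp (-(a * x)))
  have h2 := laplace_const ha (a / 2)
  rw [laplace] at h2
  simp only [mul_comm _ (a / 2)] at h2
  rw [integral_undef hc, h2] at h
  have : 0 < 2 * (a / 2 / a) := by positivity
  linarith

theorem laplace_cos {a : ℝ} (ha : 0 < a) (ξ : ℝ) :
    laplace (fun s => Real.cos (ξ * s)) a = a / (a ^ 2 + ξ ^ 2) := by
  set z : ℂ := -a + ξ * Complex.I with hz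
  have hre : z.re < 0 := by simpa [hz] using ha
  have h := integral_exp_mul_complex_Ioi hre 0
  have hi := integrableOn_exp_mul_complex_Ioi hre 0
  have h2 := congrArg Complex.re h
  rw [← RCLike.re_eq_complex_re, ← integral_re hi] at h2
  rw [laplace]
  refine Eq.trans (setIntegral_congr_fun measurableSet_Ioi fun s _ => ?_) (h2.trans ?_)
  · simp only [RCLike.re_eq_complex_re]
    rw [Complex.exp_re]
    simp [hz]
  · simp only [RCLike.re_eq_complex_re, hz]
    rw [Complex.ofReal_zero, mul_zero, Complex.exp_zero, Complex.div_re]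
    simp [Complex.normSq_apply]
    ring

theorem charFun_laplaceLaw {a : ℝ} (ha : 0 < a) (ξ : ℝ) :
    charFun (laplaceLaw a) ξ = ((1 / (1 + ξ ^ 2 * (a ^ 2)⁻¹) : ℝ) : ℂ) := by
  have := isFiniteMeasure_laplaceLaw ha
  have hsin : ∫ x, Real.sin (ξ * x) ∂(laplaceLaw a) = 0 := by
    rw [integral_laplaceLaw ha]
    have h := integral_neg_eq_self
      (fun x => a / 2 * Real.exp (-(a * |x|)) * Real.sin (ξ * x)) volume
    simp only [abs_neg, mul_neg, Real.sin_neg, integral_neg] at h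
    linarith
  have hcos : ∫ x, Real.cos (ξ * x) ∂(laplaceLaw a) = 1 / (1 + ξ ^ 2 * (a ^ 2)⁻¹) := by
    have h : ∀ x, Real.cos (ξ * x) = Real.cos (ξ * |x|) := fun x => by
      rcases abs_choice x with hx | hx <;> rw [hx]
      rw [mul_neg, Real.cos_neg]
    rw [funext h, integral_abs_laplaceLaw ha fun x => Real.cos (ξ * x), laplace_cos ha]
    field_simp
  rw [charFun_eq_cos_add_sin, hsin, hcos]
  simp

/-! ### Self-similarity and exponential times -/

namespace IsFundamentalSolution

variable {ν : ℝ} {q : ℝ → Measure ℝ}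

/-- Self-similarity of the fundamental solution. -/
theorem eq_map_mul (hq : IsFundamentalSolution (2 * ν) q) (hν0 : 0 < ν) (hν1 : ν ≤ 1)
    {t : ℝ} (ht : 0 ≤ t) : q t = (q 1).map (fun x => t ^ ν * x) := by
  have h1 := hq.isProbabilityMeasure 1 zero_le_one
  have h2 := hq.isProbabilityMeasure t ht
  refine Measure.ext_of_charFun (funext fun ξ => ?_)
  rw [charFun_map_mul, charFun_eq_cos_add_sin, charFun_eq_cos_add_sin,
    hq.integral_sin_mul (by linarith) (by linarith) _ ht,
    hq.integral_sin_mul (by linarith) (by linarith) _ zero_le_one,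
    hq.integral_cos_scale hν0 hν1 ξ ht, mul_comm ξ]

theorem integral_comp_eq (hq : IsFundamentalSolution (2 * ν) q) (hν0 : 0 < ν) (hν1 : ν ≤ 1)
    {t : ℝ} (ht : 0 ≤ t) {g : ℝ → ℝ} (hg : Continuous g) :
    ∫ x, g x ∂(q t) = ∫ x, g (t ^ ν * x) ∂(q 1) := by
  rw [hq.eq_map_mul hν0 hν1 ht, integral_map (by fun_prop) (by fun_prop)]

/-- At an independent exponential time the fundamental solution has a Laplace law. -/
theorem map_expLaw_prod (hq : IsFundamentalSolution (2 * ν) q) (hν0 : 0 < ν) (hν1 : ν ≤ 1)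
    {u : ℝ} (hu : 0 < u) :
    ((expLaw u).prod (q 1)).map (fun p => p.1 ^ ν * p.2) = laplaceLaw (u ^ ν) := by
  have ha : 0 < u ^ ν := Real.rpow_pos_of_pos hu ν
  have := isFiniteMeasure_laplaceLaw ha
  have := isFiniteMeasure_expLaw hu
  have := hq.isProbabilityMeasure 1 zero_le_one
  refine Measure.ext_of_charFun (funext fun ξ => ?_)
  have hm : Measurable fun p : ℝ × ℝ => p.1 ^ ν * p.2 := by fun_prop
  rw [charFun_laplaceLaw ha, charFun_apply_real, integral_map hm.aemeasurable (by fun_prop),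
    integral_prod]
  -- Writing `q t` as the image of `q 1` under scaling makes the mixture an image of a product
  -- measure; no measurability of `t ↦ q t` has to be established.
  · have h : ∀ᵐ t ∂(expLaw u), ∫ x, Complex.exp (ξ * ((t ^ ν * x : ℝ) : ℂ) * Complex.I) ∂(q 1)
        = ((∫ x, Real.cos (ξ * x) ∂(q t) : ℝ) : ℂ) := by
      filter_upwards [ae_expLaw_pos u] with t ht
      rw [hq.integral_cos_scale hν0 hν1 ξ ht.le]
      have h1 := charFun_eq_cos_add_sin (q 1) (ξ * t ^ ν)
      rw [hq.integral_sin_mul (by linarith) (by linarith) _ zero_le_one, charFun_apply_real]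
        at h1
      simp only [Complex.ofReal_zero, zero_mul, add_zero] at h1
      rw [← h1]
      refine integral_congr_ae (Eventually.of_forall fun x => ?_)
      simp only
      push_cast
      ring_nf
    rw [integral_congr_ae h, integral_complex_ofReal, integral_expLaw hu,
      (hq.integral_cos_mul (by linarith) (by linarith) ξ).2 u hu, Real.rpow_neg hu.le,
      mul_comm 2 ν, Real.rpow_mul hu.le, Real.rpow_two]
  · refine Integrable.of_bound (C := 1) ?_ (Eventually.of_forall fun p => ?_)
    · have : Continuous fun x : ℝ => Complex.exp (ξ * (x : ℂ) * Complex.I) := by fun_prop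
      exact (this.measurable.comp hm).aestronglyMeasurable
    · rw [← Complex.ofReal_mul, Complex.norm_exp_ofReal_mul_I]

/-- Both sides are the expectation of `f` at the folded solution taken at an exponential time of
rate `u`, which is exponential of rate `u^ν`. -/
theorem laplace_integral_abs (hq : IsFundamentalSolution (2 * ν) q) (hν0 : 0 < ν) (hν1 : ν ≤ 1)
    {f : ℝ → ℝ} {C : ℝ} (hf : ContinuousOn f (Ici 0)) (hC : ∀ s, 0 ≤ s → |f s| ≤ C)
    {u : ℝ} (hu : 0 < u) :
    u * laplace (fun t => ∫ x, f |x| ∂(q t)) u = u ^ ν * laplace f (u ^ ν) := by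
  have ha : 0 < u ^ ν := Real.rpow_pos_of_pos hu ν
  have := isFiniteMeasure_expLaw hu
  have := hq.isProbabilityMeasure 1 zero_le_one
  have hfc : Continuous fun x => f |x| :=
    hf.comp_continuous continuous_abs fun x => abs_nonneg x
  have hm : Measurable fun p : ℝ × ℝ => p.1 ^ ν * p.2 := by fun_prop
  rw [← integral_abs_laplaceLaw ha, ← hq.map_expLaw_prod hν0 hν1 hu,
    integral_map hm.aemeasurable hfc.aestronglyMeasurable, integral_prod, ← integral_expLaw hu]
  · refine integral_congr_ae ?_
    filter_upwards [ae_expLaw_pos u] with t ht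
    rw [hq.integral_comp_eq hν0 hν1 ht.le hfc]
  · exact Integrable.of_bound (C := C) (hfc.measurable.comp hm).aestronglyMeasurable
      (Eventually.of_forall fun p => hC _ (abs_nonneg _))

end IsFundamentalSolution

/-! ### Subordination and the Caputo derivative -/

theorem _root_.AbsolutelyContinuousOnInterval.congr {f g : ℝ → ℝ} {a b : ℝ}
    (hf : AbsolutelyContinuousOnInterval f a b) (h : EqOn f g (uIcc a b)) :
    AbsolutelyContinuousOnInterval g a b := by
  rw [absolutelyContinuousOnInterval_iff] at hf ⊢
  intro ε hε
  obtain ⟨δ, hδ, H⟩ := hf ε hε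
  refine ⟨δ, hδ, fun E hE hlt => lt_of_eq_of_lt ?_ (H E hE hlt)⟩
  refine Finset.sum_congr rfl fun i hi => ?_
  have := hE.1 i hi
  rw [h this.1, h this.2]

theorem continuousOn_integral_comp_rpow_mul_abs {m : Measure ℝ} {w k : ℝ → ℝ} {ν D : ℝ}
    (hν : 0 < ν) (hw : Integrable w m) (hk : ContinuousOn k (Ici 0))
    (hD : ∀ s, 0 ≤ s → |k s| ≤ D) :
    ContinuousOn (fun t => ∫ x, w x * k (t ^ ν * |x|) ∂m) (Ici 0) := by
  refine continuousOn_of_dominated (bound := fun x => ‖w x‖ * D) (fun t ht => ?_)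
    (fun t ht => Eventually.of_forall fun x => ?_) (hw.norm.mul_const D)
    (Eventually.of_forall fun x => ?_)
  · refine hw.aestronglyMeasurable.mul (Continuous.aestronglyMeasurable ?_)
    exact hk.comp_continuous (by fun_prop) fun x =>
      mul_nonneg (Real.rpow_nonneg ht _) (abs_nonneg x)
  · rw [norm_mul]
    exact mul_le_mul_of_nonneg_left
      (hD _ (mul_nonneg (Real.rpow_nonneg ht _) (abs_nonneg x))) (norm_nonneg _)
  · refine continuousOn_const.mul (hk.comp (t := Ici 0) ?_ fun t ht =>
      mul_nonneg (Real.rpow_nonneg ht _) (abs_nonneg x))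
    exact ((Real.continuous_rpow_const hν.le).mul continuous_const).continuousOn

/-- Differentiation under the integral. On `(t/2, ∞)` the factor `s^(ν-1)` is at most `(t/2)^(ν-1)`
because `ν ≤ 1`, and the first absolute moment dominates the rest. At `x = 0` the integrand is
constant, so differentiability of `f` at `0` is not needed. -/
theorem hasDerivAt_integral_comp_rpow_mul_abs {m : Measure ℝ} [IsFiniteMeasure m] {f d : ℝ → ℝ}
    {ν C D t : ℝ} (hν0 : 0 < ν) (hν1 : ν ≤ 1) (hm : Integrable (fun x => |x|) m)
    (hf : ContinuousOn f (Ici 0)) (hd : ContinuousOn d (Ici 0))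
    (hfd : ∀ s, 0 < s → HasDerivAt f (d s) s) (hC : ∀ s, 0 ≤ s → |f s| ≤ C)
    (hD : ∀ s, 0 ≤ s → |d s| ≤ D) (ht : 0 < t) :
    HasDerivAt (fun t => ∫ x, f (t ^ ν * |x|) ∂m)
      (ν * t ^ (ν - 1) * ∫ x, |x| * d (t ^ ν * |x|) ∂m) t := by
  have hnn : ∀ (s x : ℝ), 0 ≤ s → 0 ≤ s ^ ν * |x| := fun s x hs =>
    mul_nonneg (Real.rpow_nonneg hs _) (abs_nonneg x)
  have hD0 : 0 ≤ D := (abs_nonneg _).trans (hD 0 le_rfl)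
  have hfm : ∀ s, 0 ≤ s → Continuous fun x => f (s ^ ν * |x|) := fun s hs =>
    hf.comp_continuous (by fun_prop) fun x => hnn s x hs
  have hdm : ∀ s, 0 ≤ s → Continuous fun x => d (s ^ ν * |x|) := fun s hs =>
    hd.comp_continuous (by fun_prop) fun x => hnn s x hs
  have h := (hasDerivAt_integral_of_dominated_loc_of_deriv_le (μ := m)
    (F := fun s x => f (s ^ ν * |x|)) (F' := fun s x => ν * s ^ (ν - 1) * (|x| * d (s ^ ν * |x|)))
    (x₀ := t) (s := Ioi (t / 2)) (bound := fun x => ν * (t / 2) ^ (ν - 1) * D * |x|)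
    (Ioi_mem_nhds (by linarith)) ?_ ?_ ?_ ?_ (hm.const_mul _) ?_).2
  · simpa only [integral_const_mul] using h
  · filter_upwards [Ioi_mem_nhds ht] with s hs
    exact (hfm s (le_of_lt hs)).aestronglyMeasurable
  · exact .of_bound (C := C) (hfm t ht.le).aestronglyMeasurable
      (Eventually.of_forall fun x => hC _ (hnn t x ht.le))
  · exact (continuous_const.mul (continuous_abs.mul (hdm t ht.le))).aestronglyMeasurable
  · refine Eventually.of_forall fun x s hs => ?_
    have hs0 : 0 < s := lt_trans (by linarith) (mem_Ioi.1 hs)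
    have h1 : s ^ (ν - 1) ≤ (t / 2) ^ (ν - 1) :=
      Real.rpow_le_rpow_of_nonpos (by linarith) (le_of_lt hs) (by linarith)
    have h2 := hD _ (hnn s x hs0.le)
    have h3 := Real.rpow_pos_of_pos hs0 (ν - 1)
    rw [norm_mul, norm_mul, norm_mul, Real.norm_eq_abs, Real.norm_eq_abs, Real.norm_eq_abs,
      Real.norm_eq_abs, abs_abs, abs_of_pos hν0, abs_of_pos h3]
    calc ν * s ^ (ν - 1) * (|x| * |d (s ^ ν * |x|)|)
        ≤ ν * (t / 2) ^ (ν - 1) * (|x| * D) := by gcongr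
      _ = _ := by ring
  · refine Eventually.of_forall fun x s hs => ?_
    have hs0 : 0 < s := lt_trans (by linarith) (mem_Ioi.1 hs)
    rcases eq_or_ne x 0 with rfl | hx
    · simpa using hasDerivAt_const s (f 0)
    · have h1 := (Real.hasDerivAt_rpow_const (x := s) (p := ν) (Or.inl hs0.ne')).mul_const |x|
      have h2 := hfd (s ^ ν * |x|) (mul_pos (Real.rpow_pos_of_pos hs0 _) (abs_pos.2 hx))
      refine (h2.comp s h1).congr_deriv ?_
      ring

/-- The fractional integral of order `1 - ν` of `s ↦ ν s ^ (ν - 1) m s`. -/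
theorem fracInt_rpow_mul {ν t : ℝ} (ht : 0 < t) (m : ℝ → ℝ) :
    fracInt (1 - ν) (fun s => ν * s ^ (ν - 1) * m s) t = ν / Real.Gamma (1 - ν) *
      ∫ r in (0 : ℝ)..1, r ^ (ν - 1) * (1 - r) ^ (1 - ν - 1) * m (t * r) := by
  have h := intervalIntegral.integral_comp_mul_left (a := 0) (b := 1)
    (fun s => ν * s ^ (ν - 1) * m s * (t - s) ^ (1 - ν - 1)) ht.ne'
  rw [mul_zero, mul_one, smul_eq_mul, eq_comm, inv_mul_eq_iff_eq_mul₀ ht.ne'] at h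
  rw [fracInt, h, ← intervalIntegral.integral_const_mul, ← intervalIntegral.integral_const_mul,
    ← intervalIntegral.integral_const_mul]
  refine intervalIntegral.integral_congr fun r hr => ?_
  rw [uIcc_of_le zero_le_one] at hr
  rw [show t - t * r = t * (1 - r) by ring, Real.mul_rpow ht.le hr.1,
    Real.mul_rpow ht.le (sub_nonneg.2 hr.2)]
  -- The powers of `t` from the substitution `s = t r` cancel, leaving `t` only inside `m`.
  have : t * t ^ (ν - 1) * t ^ (1 - ν - 1) = 1 := by
    have h1 : t * t ^ (ν - 1) = t ^ ν := by
      rw [mul_comm, ← Real.rpow_add_one ht.ne', sub_add_cancel]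
    rw [h1, ← Real.rpow_add ht, show ν + (1 - ν - 1) = 0 by ring, Real.rpow_zero]
  calc 1 / Real.Gamma (1 - ν) * (t * (ν * (t ^ (ν - 1) * r ^ (ν - 1)) * m (t * r) *
        (t ^ (1 - ν - 1) * (1 - r) ^ (1 - ν - 1))))
      = (t * t ^ (ν - 1) * t ^ (1 - ν - 1)) * (ν / Real.Gamma (1 - ν) * (r ^ (ν - 1) *
        (1 - r) ^ (1 - ν - 1) * m (t * r))) := by ring
    _ = _ := by rw [this, one_mul]

/-- Continuity and boundedness of this form of `I^{1-ν} G'` are what allow equality of Laplace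
transforms to become equality at every time. -/
theorem continuousOn_integral_beta_kernel {ν E : ℝ} {m : ℝ → ℝ} (hν0 : 0 < ν) (hν1 : ν < 1)
    (hm : ContinuousOn m (Ici 0)) (hE : ∀ t, 0 ≤ t → |m t| ≤ E) :
    ContinuousOn (fun t => ∫ r in (0 : ℝ)..1, r ^ (ν - 1) * (1 - r) ^ (1 - ν - 1) * m (t * r))
      (Ici 0) ∧
    ∃ B, ∀ t, 0 ≤ t →
      |∫ r in (0 : ℝ)..1, r ^ (ν - 1) * (1 - r) ^ (1 - ν - 1) * m (t * r)| ≤ B := by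
  have hi := intervalIntegrable_sub_rpow_mul_sub_rpow (r := 0) (t := 1) hν0 (sub_pos.2 hν1)
    one_pos
  simp only [sub_zero] at hi
  rw [intervalIntegrable_iff_integrableOn_Ioc_of_le zero_le_one] at hi
  have hb : ∀ t, 0 ≤ t → ∀ r ∈ Ioc (0 : ℝ) 1,
      ‖r ^ (ν - 1) * (1 - r) ^ (1 - ν - 1) * m (t * r)‖
        ≤ r ^ (ν - 1) * (1 - r) ^ (1 - ν - 1) * E := fun t ht r hr => by
    rw [norm_mul, Real.norm_of_nonneg (mul_nonneg (Real.rpow_nonneg hr.1.le _)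
      (Real.rpow_nonneg (sub_nonneg.2 hr.2) _))]
    exact mul_le_mul_of_nonneg_left (hE _ (mul_nonneg ht hr.1.le))
      (mul_nonneg (Real.rpow_nonneg hr.1.le _) (Real.rpow_nonneg (sub_nonneg.2 hr.2) _))
  simp only [intervalIntegral.integral_of_le zero_le_one]
  refine ⟨?_, ∫ r in Ioc (0 : ℝ) 1, r ^ (ν - 1) * (1 - r) ^ (1 - ν - 1) * E, fun t ht => ?_⟩
  · refine continuousOn_of_dominated (fun t ht => ?_) (fun t ht => ?_) (hi.mul_const E) ?_
    · refine hi.aestronglyMeasurable.mul (ContinuousOn.aestronglyMeasurable ?_ measurableSet_Ioc)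
      exact hm.comp (by fun_prop) fun r hr => mul_nonneg ht hr.1.le
    · filter_upwards [ae_restrict_mem measurableSet_Ioc] with r hr
      exact hb t ht r hr
    · filter_upwards [ae_restrict_mem measurableSet_Ioc] with r hr
      exact continuousOn_const.mul (hm.comp (by fun_prop) fun t ht => mul_nonneg ht hr.1.le)
  · rw [← Real.norm_eq_abs]
    refine norm_integral_le_of_norm_le (hi.mul_const E) ?_
    filter_upwards [ae_restrict_mem measurableSet_Ioc] with r hr
    exact hb t ht r hr

/-- The singularity `t^(ν-1)` of `G'` is integrable, which gives absolute continuity and convergence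
of the Caputo integral. Hypothesis `hL` says that `G'` has transform `u^{1-ν} Ĥ(u)`; hence `I^{1-ν}
G'` and `H` have the same transform, and both are bounded and continuous. For `ν = 1` the comparison
is between `m = G'` and `H` directly. -/
theorem hasCaputoDeriv_of_hasDerivAt_rpow_mul {ν E B : ℝ} {G m H : ℝ → ℝ} (hν0 : 0 < ν)
    (hν1 : ν ≤ 1) (hG : ContinuousOn G (Ici 0))
    (hGd : ∀ t, 0 < t → HasDerivAt G (ν * t ^ (ν - 1) * m t) t)
    (hm : ContinuousOn m (Ici 0)) (hE : ∀ t, 0 ≤ t → |m t| ≤ E)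
    (hH : ContinuousOn H (Ici 0)) (hB : ∀ t, 0 ≤ t → |H t| ≤ B)
    (hL : ∀ u, 0 < u → u * laplace G u = G 0 + u ^ (1 - ν) * laplace H u) :
    HasCaputoDeriv ν G H := by
  have hceil : ⌈ν⌉₊ = 1 := by
    rw [Nat.ceil_eq_iff one_ne_zero]; simpa using ⟨hν0, hν1⟩
  set g : ℝ → ℝ := fun s => ν * s ^ (ν - 1) * m s with hg
  have hmm : AEStronglyMeasurable m (volume.restrict (Ioi 0)) :=
    (hm.mono Ioi_subset_Ici_self).aestronglyMeasurable measurableSet_Ioi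
  have hgm : AEStronglyMeasurable g (volume.restrict (Ioi 0)) :=
    (Measurable.aestronglyMeasurable (by fun_prop)).mul hmm
  have hgb : ∀ t, 0 < t → |g t| ≤ ν * E * t ^ (ν - 1) := fun t ht => by
    have h1 := Real.rpow_pos_of_pos ht (ν - 1)
    rw [hg, abs_mul, abs_mul, abs_of_pos hν0, abs_of_pos h1]
    have := mul_le_mul_of_nonneg_left (hE t ht.le) (mul_pos hν0 h1).le
    linarith
  have hgi : ∀ t, 0 < t → IntervalIntegrable g volume 0 t := fun t ht => by
    rw [intervalIntegrable_iff_integrableOn_Ioc_of_le ht.le]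
    have h1 := (intervalIntegral.intervalIntegrable_rpow' (a := 0) (b := t)
      (show -1 < ν - 1 by linarith)).const_mul (ν * E)
    rw [intervalIntegrable_iff_integrableOn_Ioc_of_le ht.le] at h1
    refine h1.mono' (hgm.mono_set Ioc_subset_Ioi_self) ?_
    filter_upwards [ae_restrict_mem measurableSet_Ioc] with s hs
    exact hgb s hs.1
  have hftc : ∀ t, 0 ≤ t → G t = G 0 + ∫ s in (0 : ℝ)..t, g s := fun t ht => by
    rcases ht.eq_or_lt with rfl | ht
    · simp
    rw [intervalIntegral.integral_eq_sub_of_hasDerivAt_of_le ht.le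
      (hG.mono Icc_subset_Ici_self) (fun s hs => hGd s hs.1) (hgi t ht)]
    ring
  have hac : ∀ t, 0 < t → AbsolutelyContinuousOnInterval G 0 t := fun t ht => by
    have h1 := (hgi t ht).absolutelyContinuousOnInterval_intervalIntegral (c := 0) (by simp)
    have h2 : AbsolutelyContinuousOnInterval (fun _ : ℝ => G 0) 0 t :=
      (LipschitzOnWith.absolutelyContinuousOnInterval (K := 0)
        ((LipschitzWith.const (G 0)).lipschitzOnWith))
    refine (h2.fun_add h1).congr fun s hs => ?_
    rw [uIcc_of_le ht.le] at hs
    exact (hftc s hs.1).symm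
  have hgL : ∀ u, 0 < u → LaplaceIntegrable g u := fun u hu => .of_bound hν0 hu hgm hgb
  have hLg : ∀ u, 0 < u → laplace g u = u ^ (1 - ν) * laplace H u := fun u hu => by
    have h1 : laplace G u = G 0 / u + u ^ (-1 : ℝ) * laplace g u := by
      rw [← laplace_const hu, ← laplace_fracInt one_pos hu (hgL u hu),
        ← laplace_add (.of_bounded hu (by fun_prop) (C := |G 0|) fun _ _ => le_rfl)
          ((hgL u hu).fracInt one_pos hu)]
      refine laplace_congr (fun t ht => ?_) u
      rw [fracInt_one, hftc t ht.le]
    have h2 := hL u hu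
    rw [h1, Real.rpow_neg_one] at h2
    have h3 : u * (G 0 / u + u⁻¹ * laplace g u) = G 0 + laplace g u := by field_simp
    linarith
  have hderiv : ∀ t, 0 < t → deriv G t = g t := fun t ht => (hGd t ht).deriv
  refine ⟨?_, ?_, fun h t ht => ?_, fun h t ht => ?_, fun h t ht => ?_⟩
  · rw [hceil]
    simpa using hG
  · intro t ht
    rw [hceil, Nat.sub_self, iteratedDerivWithin_zero]
    exact hac t ht
  · rw [hceil, Nat.cast_one] at h
    rw [hceil, Nat.sub_self, iteratedDerivWithin_zero]
    refine (hGd t ht).congr_deriv ?_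
    have hgm : ∀ t, 0 < t → g t = m t := fun t _ => by simp [hg, h]
    refine (hgm t ht).trans (eq_of_laplace_eq hm hH hE hB (fun u hu => ?_) t ht.le)
    rw [← laplace_congr hgm, hLg u hu, h, sub_self, Real.rpow_zero, one_mul]
  · rw [hceil, Nat.cast_one] at h
    simp only [hceil, Nat.sub_self, iteratedDerivWithin_zero, Nat.cast_one]
    have hlt : 0 < 1 - ν := sub_pos.2 (lt_of_le_of_ne hν1 h)
    have hi := intervalIntegrable_sub_rpow_mul_sub_rpow hν0 hlt ht
    rw [intervalIntegrable_iff_integrableOn_Ioc_of_le ht.le] at hi ⊢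
    refine (hi.const_mul (ν * E)).mono' ?_ ?_
    · refine AEStronglyMeasurable.mul ?_
        (by fun_prop : Measurable fun s => (t - s) ^ (1 - ν - 1)).aestronglyMeasurable
      refine (hgm.mono_set Ioc_subset_Ioi_self).congr ?_
      filter_upwards [ae_restrict_mem measurableSet_Ioc] with s hs
      exact (hderiv s hs.1).symm
    · filter_upwards [ae_restrict_mem measurableSet_Ioc] with s hs
      have h1 := Real.rpow_nonneg (sub_nonneg.2 hs.2) (1 - ν - 1)
      rw [hderiv s hs.1, norm_mul, Real.norm_of_nonneg h1, sub_zero, ← mul_assoc]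
      exact mul_le_mul_of_nonneg_right (hgb s hs.1) h1
  · rw [hceil, Nat.cast_one] at h
    simp only [hceil, Nat.sub_self, iteratedDerivWithin_zero, Nat.cast_one]
    have hlt : 0 < 1 - ν := sub_pos.2 (lt_of_le_of_ne hν1 h)
    change H t = fracInt (1 - ν) (deriv G) t
    rw [fracInt_congr ht.le fun s hs _ => hderiv s hs, fracInt_rpow_mul ht]
    obtain ⟨hc, K, hK⟩ := continuousOn_integral_beta_kernel hν0 (lt_of_le_of_ne hν1 h) hm hE
    refine eq_of_laplace_eq (D := |ν / Real.Gamma (1 - ν)| * K) (g := fun t =>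
      ν / Real.Gamma (1 - ν) * ∫ r in (0 : ℝ)..1, r ^ (ν - 1) * (1 - r) ^ (1 - ν - 1) * m (t * r)) hH
      (continuousOn_const.mul hc) hB (fun s hs => ?_) (fun u hu => ?_) t ht.le
    · rw [abs_mul]
      exact mul_le_mul_of_nonneg_left (hK s hs) (abs_nonneg _)
    · rw [← laplace_congr (fun s hs => fracInt_rpow_mul (ν := ν) hs m), laplace_fracInt hlt hu (hgL u hu),
        hLg u hu, ← mul_assoc, ← Real.rpow_add hu, neg_add_cancel, Real.rpow_zero, one_mul]

namespace IsFundamentalSolution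

variable {ν : ℝ} {q : ℝ → Measure ℝ}

/-- Subordination: averaging a smooth function over the folded fundamental solution of order `2ν`
turns its derivative into a Caputo derivative of order `ν`. -/
theorem hasCaputoDeriv_integral_abs (hq : IsFundamentalSolution (2 * ν) q) (hν0 : 0 < ν)
    (hν1 : ν ≤ 1) {f d G H : ℝ → ℝ} {C D : ℝ} (hf : ContinuousOn f (Ici 0))
    (hd : ContinuousOn d (Ici 0)) (hfd : ∀ s, 0 < s → HasDerivAt f (d s) s)
    (hC : ∀ s, 0 ≤ s → |f s| ≤ C) (hD : ∀ s, 0 ≤ s → |d s| ≤ D)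
    (hG : ∀ t, 0 ≤ t → G t = ∫ x, f |x| ∂(q t)) (hH : ∀ t, 0 ≤ t → H t = ∫ x, d |x| ∂(q t)) :
    HasCaputoDeriv ν G H := by
  have hprob := hq.isProbabilityMeasure 1 zero_le_one
  have hq1 : Integrable (fun x => |x|) (q 1) :=
    hq.integrable_abs (by linarith) (by linarith) zero_le_one
  have hscale : ∀ {k : ℝ → ℝ}, ContinuousOn k (Ici 0) → ∀ t, 0 ≤ t →
      ∫ x, k |x| ∂(q t) = ∫ x, k (t ^ ν * |x|) ∂(q 1) := fun {k} hk t ht => by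
    rw [hq.integral_comp_eq hν0 hν1 ht (g := fun x => k |x|)
      (hk.comp_continuous continuous_abs fun x => abs_nonneg x)]
    simp only [abs_mul, abs_of_nonneg (Real.rpow_nonneg ht ν)]
  have hcont : ∀ {k K : ℝ → ℝ} {B : ℝ}, ContinuousOn k (Ici 0) → (∀ s, 0 ≤ s → |k s| ≤ B) →
      (∀ t, 0 ≤ t → K t = ∫ x, k |x| ∂(q t)) → ContinuousOn K (Ici 0) :=
    fun {k K B} hk hB hK => by
    refine (continuousOn_integral_comp_rpow_mul_abs (m := q 1) (w := fun _ => 1) hν0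
      (integrable_const 1) hk hB).congr fun t ht => ?_
    simp only [one_mul]
    rw [hK t ht, hscale hk t ht]
  -- Integration by parts, in the form of the transform of `f = f 0 + I^1 d`.
  have hfL : ∀ a, 0 < a → a * laplace f a = f 0 + laplace d a := fun a ha => by
    have hdL : LaplaceIntegrable d a := .of_bounded ha
      ((hd.mono Ioi_subset_Ici_self).aestronglyMeasurable measurableSet_Ioi)
      fun t ht => hD t ht.le
    have h1 : laplace f a = f 0 / a + a ^ (-1 : ℝ) * laplace d a := by
      rw [← laplace_const ha, ← laplace_fracInt one_pos ha hdL,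
        ← laplace_add (.of_bounded ha (by fun_prop) (C := |f 0|) fun _ _ => le_rfl)
          (hdL.fracInt one_pos ha)]
      refine laplace_congr (fun t ht => ?_) a
      rw [fracInt_one, intervalIntegral.integral_eq_sub_of_hasDerivAt_of_le ht.le
        (hf.mono Icc_subset_Ici_self) (fun s hs => hfd s hs.1)]
      · ring
      · refine (hd.mono ?_).intervalIntegrable
        rw [uIcc_of_le ht.le]
        exact Icc_subset_Ici_self
    rw [h1, Real.rpow_neg_one]
    field_simp
  refine hasCaputoDeriv_of_hasDerivAt_rpow_mul (E := (∫ x, |x| ∂(q 1)) * D) (B := D)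
    (m := fun t => ∫ x, |x| * d (t ^ ν * |x|) ∂(q 1)) hν0 hν1 (hcont hf hC hG) (fun t ht => ?_)
    (continuousOn_integral_comp_rpow_mul_abs hν0 hq1 hd hD) (fun t ht => ?_)
    (hcont hd hD hH) (fun t ht => ?_) (fun u hu => ?_)
  · refine (hasDerivAt_integral_comp_rpow_mul_abs hν0 hν1 hq1 hf hd hfd hC hD ht).congr_of_eventuallyEq
      ?_
    filter_upwards [Ioi_mem_nhds ht] with s hs
    rw [hG s (le_of_lt hs), hscale hf s (le_of_lt hs)]
  · rw [← integral_mul_const, ← Real.norm_eq_abs]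
    refine norm_integral_le_of_norm_le (hq1.mul_const D) (Eventually.of_forall fun x => ?_)
    rw [norm_mul, Real.norm_eq_abs, abs_abs]
    exact mul_le_mul_of_nonneg_left
      (hD _ (mul_nonneg (Real.rpow_nonneg ht _) (abs_nonneg x))) (abs_nonneg x)
  · rw [hH t ht]
    exact hq.abs_integral_le ht fun x => hD _ (abs_nonneg x)
  -- With `a = u^ν`: `u Ĝ(u) = a f̂(a) = f 0 + d̂(a)` and `a d̂(a) = u Ĥ(u)`.
  · have ha := Real.rpow_pos_of_pos hu ν
    have h1 := hq.laplace_integral_abs hν0 hν1 hf hC hu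
    have h2 := hq.laplace_integral_abs hν0 hν1 hd hD hu
    rw [← laplace_congr (fun t ht => hG t ht.le)] at h1
    rw [← laplace_congr (fun t ht => hH t ht.le)] at h2
    have hG0 : G 0 = f 0 := by rw [hG 0 le_rfl, hq.initial, integral_dirac, abs_zero]
    rw [h1, hfL _ ha, hG0]
    congr 1
    refine mul_left_cancel₀ ha.ne' (h2.symm.trans ?_)
    rw [← mul_assoc, ← Real.rpow_add hu, add_sub_cancel, Real.rpow_one]

end IsFundamentalSolution

/-! ### Uniqueness for the birth–death system -/

/-- The only summable solution of the resolvent equation of the linear birth–death system is `0`. -/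
theorem eq_zero_of_summable_of_resolvent {birth death a : ℝ} (hb : 0 < birth) (hd : 0 < death)
    (ha : 0 < a) {x : ℕ → ℝ} (hs : Summable fun k => x (k + 1))
    (hx : ∀ k : ℕ, 1 ≤ k → a * x k = -(birth + death) * k * x k
      + birth * ((k : ℝ) - 1) * x (k - 1) + death * ((k : ℝ) + 1) * x (k + 1)) :
    ∀ k, 1 ≤ k → x k = 0 := by
  have hpos : ∀ y : ℕ → ℝ, (Summable fun k => y (k + 1)) →
      (∀ k : ℕ, 1 ≤ k → a * y k = -(birth + death) * k * y k
        + birth * ((k : ℝ) - 1) * y (k - 1) + death * ((k : ℝ) + 1) * y (k + 1)) →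
      ¬ 0 < y 1 := by
    intro y hys hy h1
    -- The net flux `death (k+1) y_{k+1} - birth k y_k` increases by `a y_{k+1}` at each step, so it
    -- never falls below `death y_1` and positivity propagates. The value `y 0` never enters, its
    -- coefficient at `k = 1` being zero.
    have key : ∀ k : ℕ, 1 ≤ k → 0 < y k ∧
        death * y 1 ≤ death * ((k : ℝ) + 1) * y (k + 1) - birth * k * y k := by
      intro k hk
      induction k, hk using Nat.le_induction with
      | base =>
        have h := hy 1 le_rfl
        refine ⟨h1, ?_⟩
        push_cast at h ⊢
        nlinarith [mul_pos ha h1]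
      | succ k hk ih =>
        have hk0 : (0 : ℝ) < k := by exact_mod_cast hk
        have hp : 0 < y (k + 1) := by
          have h2 : 0 < death * ((k : ℝ) + 1) * y (k + 1) := by
            have := mul_pos (mul_pos hb hk0) ih.1
            have := mul_pos hd h1
            linarith [ih.2]
          exact (mul_pos_iff_of_pos_left (by positivity)).1 h2
        refine ⟨hp, ?_⟩
        have h := hy (k + 1) (by omega)
        rw [Nat.add_sub_cancel] at h
        push_cast at h ⊢
        nlinarith [mul_pos ha hp, ih.2]
    -- Dropping the birth term from the flux bound leaves a harmonic lower bound.
    have hle : ∀ k : ℕ, y 1 * (1 / ((k : ℝ) + 1)) ≤ y (k + 1) := by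
      intro k
      rw [mul_one_div, div_le_iff₀ (by positivity)]
      rcases Nat.eq_zero_or_pos k with rfl | hk
      · simp
      · have h := (key k hk).2
        have h2 : 0 ≤ birth * k * y k := by
          have := (key k hk).1
          positivity
        have h3 : death * y 1 ≤ death * (y (k + 1) * ((k : ℝ) + 1)) := by linarith
        exact le_of_mul_le_mul_left h3 hd
    have h4 : Summable fun k : ℕ => y 1 * (1 / ((k : ℝ) + 1)) :=
      hys.of_nonneg_of_le (fun k => by positivity) hle
    rw [summable_mul_left_iff h1.ne'] at h4
    refine Real.not_summable_one_div_natCast ((summable_nat_add_iff 1).1 ?_)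
    simpa using h4
  have h1 : x 1 = 0 := by
    refine le_antisymm (not_lt.1 (hpos x hs hx)) (not_lt.1 fun h => ?_)
    refine hpos (fun k => -x k) hs.neg (fun k hk => ?_) (neg_pos.2 h)
    have := hx k hk
    linarith
  -- The recursion determines each next term from the two before, since `death (k+1) ≠ 0`.
  have key : ∀ k : ℕ, 1 ≤ k → x k = 0 ∧ x (k + 1) = 0 := by
    intro k hk
    induction k, hk using Nat.le_induction with
    | base =>
      have h := hx 1 le_rfl
      refine ⟨h1, ?_⟩
      simp only [h1, Nat.cast_one, sub_self, mul_zero, zero_mul, zero_add, eq_comm (a := (0 : ℝ)),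
        mul_eq_zero] at h
      rcases h with h | h
      · rcases h with h | h
        · exact absurd h hd.ne'
        · norm_num at h
      · exact h
    | succ k hk ih =>
      have h := hx (k + 1) (by omega)
      rw [Nat.add_sub_cancel, ih.1, ih.2] at h
      refine ⟨ih.2, ?_⟩
      simp only [mul_zero, zero_add, eq_comm (a := (0 : ℝ)), mul_eq_zero] at h
      rcases h with h | h
      · rcases h with h | h
        · exact absurd h hd.ne'
        · have : (0 : ℝ) < ((k + 1 : ℕ) : ℝ) + 1 := by positivity
          exact absurd h this.ne'
      · exact h
  exact fun k hk => (key k hk).1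

namespace SolvesBirthDeathSystem

variable {ν birth death : ℝ} {i : ℕ} {p : ℕ → ℝ → ℝ}

theorem le_one (hp : SolvesBirthDeathSystem ν birth death i p) (k : ℕ) {t : ℝ} (ht : 0 ≤ t) :
    p k t ≤ 1 :=
  le_hasSum (hp.hasSum_one t ht) k fun j _ => hp.nonneg j t ht

theorem abs_le_one (hp : SolvesBirthDeathSystem ν birth death i p) (k : ℕ) {t : ℝ} (ht : 0 ≤ t) :
    |p k t| ≤ 1 := by
  rw [abs_of_nonneg (hp.nonneg k t ht)]
  exact hp.le_one k ht

theorem continuousOn (hp : SolvesBirthDeathSystem ν birth death i p) {k : ℕ} (hk : 1 ≤ k) :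
    ContinuousOn (p k) (Ici 0) :=
  (hp.equation k hk).contDiffOn.continuousOn

/-- The case `k = 1` is separate: `p 0` satisfies no equation and has no assumed regularity, but its
coefficient is zero. -/
theorem continuousOn_pred (hp : SolvesBirthDeathSystem ν birth death i p) {k : ℕ} (hk : 1 ≤ k) :
    ContinuousOn (fun t => birth * ((k : ℝ) - 1) * p (k - 1) t) (Ici 0) := by
  rcases hk.eq_or_lt with rfl | hk
  · simpa using continuousOn_const
  · exact continuousOn_const.mul (hp.continuousOn (by omega))

theorem continuousOn_rhs (hp : SolvesBirthDeathSystem ν birth death i p) {k : ℕ} (hk : 1 ≤ k) :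
    ContinuousOn (fun t => -(birth + death) * k * p k t + birth * ((k : ℝ) - 1) * p (k - 1) t
      + death * ((k : ℝ) + 1) * p (k + 1) t) (Ici 0) :=
  ((continuousOn_const.mul (hp.continuousOn hk)).add (hp.continuousOn_pred hk)).add
    (continuousOn_const.mul (hp.continuousOn (by omega)))

theorem abs_rhs_le (hp : SolvesBirthDeathSystem ν birth death i p) (k : ℕ) {t : ℝ} (ht : 0 ≤ t) :
    |-(birth + death) * k * p k t + birth * ((k : ℝ) - 1) * p (k - 1) t
      + death * ((k : ℝ) + 1) * p (k + 1) t|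
    ≤ |-(birth + death) * k| + |birth * ((k : ℝ) - 1)| + |death * ((k : ℝ) + 1)| := by
  refine (abs_add_three _ _ _).trans ?_
  have h : ∀ (c : ℝ) (j : ℕ), |c * p j t| ≤ |c| := fun c j => by
    rw [abs_mul]
    exact mul_le_of_le_one_right (abs_nonneg c) (hp.abs_le_one j ht)
  exact add_le_add_three (h _ _) (h _ _) (h _ _)

theorem laplaceIntegrable (hp : SolvesBirthDeathSystem ν birth death i p) {k : ℕ} (hk : 1 ≤ k)
    {u : ℝ} (hu : 0 < u) : LaplaceIntegrable (p k) u :=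
  .of_bounded hu (((hp.continuousOn hk).mono Ioi_subset_Ici_self).aestronglyMeasurable
    measurableSet_Ioi) fun _ ht => hp.abs_le_one k ht.le

/-- The Laplace transforms of a solution satisfy the resolvent equation of the system. -/
theorem laplace_eq (hp : SolvesBirthDeathSystem ν birth death i p) (hν0 : 0 < ν) (hν1 : ν ≤ 1)
    {k : ℕ} (hk : 1 ≤ k) {u : ℝ} (hu : 0 < u) :
    u ^ ν * laplace (p k) u = u ^ ν * ((if k = i then 1 else 0) / u) +
      (-(birth + death) * k * laplace (p k) u + birth * ((k : ℝ) - 1) * laplace (p (k - 1)) u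
        + death * ((k : ℝ) + 1) * laplace (p (k + 1)) u) := by
  have hpred : LaplaceIntegrable (fun t => birth * ((k : ℝ) - 1) * p (k - 1) t) u := by
    rcases hk.eq_or_lt with rfl | hk
    · simpa using LaplaceIntegrable.of_bounded hu (g := fun _ => (0 : ℝ)) (C := 0) (by fun_prop)
        (by simp)
    · exact (hp.laplaceIntegrable (by omega) hu).const_mul _
  have h1 := (hp.laplaceIntegrable hk hu).const_mul (-(birth + death) * k)
  have h2 := (hp.laplaceIntegrable (k := k + 1) (by omega) hu).const_mul (death * ((k : ℝ) + 1))
  have h := laplace_congr (fun t ht =>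
    (hp.equation k hk).eq_add_fracInt_of_le_one hν0 hν1 (le_of_lt ht)) u
  rw [laplace_add (.of_bounded hu (by fun_prop) (C := |p k 0|) fun _ _ => le_rfl)
    (((h1.add hpred).add h2).fracInt hν0 hu), laplace_const hu,
    laplace_fracInt hν0 hu ((h1.add hpred).add h2), laplace_add (h1.add hpred) h2,
    laplace_add h1 hpred, laplace_const_mul, laplace_const_mul, laplace_const_mul,
    hp.initial] at h
  have h3 : u ^ ν * u ^ (-ν) = 1 := by rw [← Real.rpow_add hu, add_neg_cancel, Real.rpow_zero]
  conv_lhs => rw [h]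
  rw [mul_add, ← mul_assoc (u ^ ν) (u ^ (-ν)), h3, one_mul]

/-- Partial sums of the probabilities are at most `1`, so those of their transforms are at most `1 /
u`. -/
theorem summable_laplace (hp : SolvesBirthDeathSystem ν birth death i p) {u : ℝ} (hu : 0 < u) :
    Summable fun k => laplace (p (k + 1)) u := by
  refine summable_of_sum_range_le (c := 1 / u) (fun k => ?_) (fun n => ?_)
  · exact setIntegral_nonneg measurableSet_Ioi fun t ht =>
      mul_nonneg (Real.exp_pos _).le (hp.nonneg _ t (le_of_lt ht))
  · have hi : ∀ k ∈ Finset.range n, Integrable (fun t => Real.exp (-(u * t)) * p (k + 1) t)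
        (volume.restrict (Ioi 0)) := fun k _ => hp.laplaceIntegrable (by omega) hu
    have hc : LaplaceIntegrable (fun _ => 1) u :=
      .of_bounded hu (by fun_prop) (C := |1|) fun _ _ => le_rfl
    rw [← laplace_const hu]
    unfold laplace
    rw [← integral_finsetSum _ hi]
    refine setIntegral_mono_on (integrable_finsetSum _ hi) hc measurableSet_Ioi fun t ht => ?_
    rw [← Finset.mul_sum]
    refine mul_le_mul_of_nonneg_left ?_ (Real.exp_pos _).le
    have hsum := hp.hasSum_one t (le_of_lt ht)
    have h2 : ∑ k ∈ Finset.range (n + 1), p k t ≤ 1 :=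
      sum_le_hasSum _ (fun j _ => hp.nonneg j t (le_of_lt ht)) hsum
    rw [Finset.sum_range_succ'] at h2
    linarith [hp.nonneg 0 t (le_of_lt ht)]

/-- Uniqueness for the fractional birth–death system. -/
theorem unique {p' : ℕ → ℝ → ℝ} (hp : SolvesBirthDeathSystem ν birth death i p)
    (hp' : SolvesBirthDeathSystem ν birth death i p') (hν0 : 0 < ν) (hν1 : ν ≤ 1)
    (hb : 0 < birth) (hd : 0 < death) (k : ℕ) {t : ℝ} (ht : 0 ≤ t) : p k t = p' k t := by
  have hpos : ∀ k, 1 ≤ k → ∀ t, 0 ≤ t → p k t = p' k t := by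
    intro k hk
    refine eq_of_laplace_eq (hp.continuousOn hk) (hp'.continuousOn hk)
      (fun t ht => hp.abs_le_one k ht) (fun t ht => hp'.abs_le_one k ht) fun u hu => ?_
    refine sub_eq_zero.1 (eq_zero_of_summable_of_resolvent hb hd (Real.rpow_pos_of_pos hu ν)
      (x := fun k => laplace (p k) u - laplace (p' k) u)
      ((hp.summable_laplace hu).sub (hp'.summable_laplace hu)) (fun k hk => ?_) k hk)
    have h1 := hp.laplace_eq hν0 hν1 hk hu
    have h2 := hp'.laplace_eq hν0 hν1 hk hu
    rw [mul_sub, h1, h2]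
    ring
  rcases Nat.eq_zero_or_pos k with rfl | hk
  -- State `0` has no equation; its probability is the complement of the others.
  · have h1 := (hasSum_nat_add_iff' 1).2 (hp.hasSum_one t ht)
    have h2 := (hasSum_nat_add_iff' 1).2 (hp'.hasSum_one t ht)
    have h3 : (fun n => p (n + 1) t) = fun n => p' (n + 1) t :=
      funext fun n => hpos (n + 1) (by omega) t ht
    rw [h3] at h1
    have h4 := h1.unique h2
    simpa using h4
  · exact hpos k hk t ht

end SolvesBirthDeathSystem

/-! ### Evaluating the process at an independent random time -/

/-- A process with discrete state space and right-continuous paths is jointly measurable. -/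
theorem measurable_uncurry_of_right_continuous {Ω : Type*} [MeasurableSpace Ω]
    {N : ℝ≥0 → Ω → ℕ} (hm : ∀ t, Measurable (N t))
    (hrc : ∀ ω s, ContinuousWithinAt (fun r => N r ω) (Ici s) s) :
    Measurable fun p : ℝ≥0 × Ω => N p.1 p.2 := by
  -- The next point of the grid of mesh `1 / (n + 1)` strictly to the right of `s`: there are
  -- countably many such points, and they approach `s` from the side on which paths are continuous.
  set D : ℕ → ℝ≥0 → ℝ≥0 := fun n s => ((⌊((n : ℝ≥0) + 1) * s⌋₊ : ℝ≥0) + 1) / ((n : ℝ≥0) + 1)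
    with hD
  have hDs : ∀ n s, s ≤ D n s ∧ D n s ≤ s + 1 / ((n : ℝ≥0) + 1) := fun n s => by
    have hn : (0 : ℝ≥0) < (n : ℝ≥0) + 1 := by positivity
    simp only [hD]
    constructor
    · rw [le_div_iff₀ hn, mul_comm]
      exact (Nat.lt_floor_add_one _).le
    · rw [add_div]
      gcongr
      rw [div_le_iff₀ hn, mul_comm s]
      exact Nat.floor_le (zero_le)
  have hlim : ∀ s, Tendsto (fun n => D n s) atTop (𝓝[≥] s) := fun s => by
    refine tendsto_nhdsWithin_iff.2 ⟨?_, Eventually.of_forall fun n => (hDs n s).1⟩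
    refine tendsto_of_tendsto_of_tendsto_of_le_of_le tendsto_const_nhds ?_
      (fun n => (hDs n s).1) (fun n => (hDs n s).2)
    simpa using (tendsto_one_div_add_atTop_nhds_zero_nat (𝕜 := ℝ≥0)).const_add s
  refine measurable_of_tendsto_metrizable (f := fun n (p : ℝ≥0 × Ω) => N (D n p.1) p.2)
    (fun n => ?_) (tendsto_pi_nhds.2 fun p => (hrc p.2 p.1).tendsto.comp (hlim p.1))
  have h1 : Measurable fun p : ℕ × Ω => N (((p.1 : ℝ≥0) + 1) / ((n : ℝ≥0) + 1)) p.2 :=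
    measurable_from_prod_countable_right fun k =>
      hm (((k : ℝ≥0) + 1) / ((n : ℝ≥0) + 1))
  exact h1.comp (f := fun p : ℝ≥0 × Ω => (⌊((n : ℝ≥0) + 1) * p.1⌋₊, p.2)) (by fun_prop)

/-- The one-dimensional distributions of a right-continuous process at an independent time. -/
theorem measure_comp_eq_lintegral {Ω : Type*} [MeasurableSpace Ω] {P : Measure Ω}
    [IsProbabilityMeasure P] {N : ℝ≥0 → Ω → ℕ} {S : Ω → ℝ≥0} (hm : ∀ t, Measurable (N t))
    (hrc : ∀ ω s, ContinuousWithinAt (fun r => N r ω) (Ici s) s) (hS : Measurable S)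
    (hind : IndepFun S (fun ω s => N s ω) P) (k : ℕ) :
    Measurable (fun s => P {ω | N s ω = k}) ∧
    P {ω | N (S ω) ω = k} = ∫⁻ s, P {ω | N s ω = k} ∂(P.map S) := by
  -- On the space of right-continuous paths evaluation is jointly measurable, which fails to be
  -- available on all of `ℝ≥0 → ℕ`. Passing to this subtype does not change the generated σ-algebra,
  -- so independence is kept.
  let W := {w : ℝ≥0 → ℕ // ∀ s, ContinuousWithinAt w (Ici s) s}
  let Y : Ω → W := fun ω => ⟨fun s => N s ω, hrc ω⟩
  have hY : Measurable Y := (measurable_pi_lambda _ hm).subtype_mk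
  have he : Measurable fun p : ℝ≥0 × W => p.2.1 p.1 :=
    measurable_uncurry_of_right_continuous (N := fun s (w : W) => w.1 s)
      (fun s => (measurable_pi_apply s).comp measurable_subtype_coe) fun w s => w.2 s
  have hind' : IndepFun S Y P := by
    rw [IndepFun_iff_Indep] at hind ⊢
    convert hind using 1
    exact MeasurableSpace.comap_comp
  have hmap := hind'.map_prod_eq_prod_map_map hS.aemeasurable hY.aemeasurable
  have hset : MeasurableSet {p : ℝ≥0 × W | p.2.1 p.1 = k} := he (measurableSet_singleton k)
  have hfib : ∀ s, (P.map Y) (Prod.mk s ⁻¹' {p : ℝ≥0 × W | p.2.1 p.1 = k})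
      = P {ω | N s ω = k} := fun s => by
    rw [Measure.map_apply hY (measurable_prodMk_left hset)]
    rfl
  have := Measure.isProbabilityMeasure_map (μ := P) hY.aemeasurable
  constructor
  · simpa only [hfib] using measurable_measure_prodMk_left (ν := P.map Y) hset
  · have h1 : P {ω | N (S ω) ω = k}
        = (P.map fun ω => (S ω, Y ω)) {p : ℝ≥0 × W | p.2.1 p.1 = k} := by
      rw [Measure.map_apply (hS.prodMk hY) hset]
      rfl
    rw [h1, hmap, Measure.prod_apply hset]
    simp only [hfib]

/-- Only the Markov property at time `0`, with trivial past and initial state `1`, is needed. -/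
theorem IsClassicalLinearBirthDeath.exists_stateProb {Ω : Type*} [MeasurableSpace Ω]
    {birth death : ℝ} {P : Measure Ω} [IsProbabilityMeasure P] {N : ℝ≥0 → Ω → ℕ}
    (hN : IsClassicalLinearBirthDeath birth death P N) :
    ∃ f : ℕ → ℝ → ℝ, SolvesBirthDeathSystem 1 birth death 1 f ∧
      ∀ (s : ℝ≥0) k, P.real {ω | N s ω = k} = f k s := by
  obtain ⟨p, hp, hmk⟩ := hN.markov
  refine ⟨p 1, hp 1, fun s k => ?_⟩
  have h := hmk 0 s 1 k univ MeasurableSet.univ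
  rw [univ_inter, zero_add] at h
  have h1 : P.real {ω | N 0 ω = 1} = 1 := by
    rw [measureReal_congr (eventuallyEq_univ.2 hN.initial), probReal_univ]
  have h2 : P.real ({ω | N 0 ω = 1} ∩ {ω | N s ω = k}) = P.real {ω | N s ω = k} := by
    refine measureReal_congr ?_
    filter_upwards [hN.initial] with ω hω
    exact propext ⟨fun h => h.2, fun h => ⟨hω, h⟩⟩
  rw [h1, h2, one_mul] at h
  exact h

theorem hasSum_measureReal_fiber {Ω : Type*} [MeasurableSpace Ω] (P : Measure Ω)
    [IsProbabilityMeasure P] {X : Ω → ℕ} (hX : Measurable X) :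
    HasSum (fun k => P.real {ω | X ω = k}) 1 := by
  have h1 : ∑' k, P {ω | X ω = k} = 1 := by
    rw [← measure_iUnion (f := fun k => {ω | X ω = k}) (fun i j hij => disjoint_left.2 fun ω h h' => hij (h.symm.trans h'))
      (fun k => hX (measurableSet_singleton k))]
    convert measure_univ (μ := P)
    exact eq_univ_of_forall fun ω => mem_iUnion.2 ⟨X ω, rfl⟩
  have h2 := ENNReal.hasSum_toReal (f := fun k => P {ω | X ω = k}) (by rw [h1]; simp)
  rwa [← ENNReal.tsum_toReal_eq (fun k => measure_ne_top _ _), h1, ENNReal.toReal_one] at h2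

theorem continuous_nnabs : Continuous Real.nnabs := by
  rw [NNReal.isEmbedding_coe.continuous_iff]
  exact continuous_abs

theorem integral_fold {m : Measure ℝ} {g : ℝ≥0 → ℝ} (hg : Measurable g) :
    ∫ s, g s ∂(fold m) = ∫ x, g (Real.nnabs x) ∂m := by
  rw [fold, integral_map continuous_nnabs.aemeasurable hg.aestronglyMeasurable]

end FracBD

end

/-! ### The main theorem -/

theorem theorem2p1 (ν birth death : ℝ) (hν0 : 0 < ν) (hν1 : ν ≤ 1)
    (hbirth : 0 < birth) (hdeath : 0 < death)
    (q : ℝ → Measure ℝ) (hq : FracBD.IsFundamentalSolution (2 * ν) q)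
    {Ω : Type*} [MeasurableSpace Ω] (P : Measure Ω) [IsProbabilityMeasure P]
    (N : ℝ≥0 → Ω → ℕ) (hN : FracBD.IsClassicalLinearBirthDeath birth death P N)
    (T : ℝ≥0 → Ω → ℝ≥0) (hTmeas : ∀ t, Measurable (T t))
    (hTlaw : ∀ t, P.map (T t) = FracBD.fold (q t))
    (hindep : ∀ t, IndepFun (T t) (fun ω s => N s ω) P) :
    FracBD.IsFractionalLinearBirthDeath ν birth death P (fun t ω => N (T t ω) ω) ∧
    ∀ {Ω' : Type*} [MeasurableSpace Ω'] (P' : Measure Ω') [IsProbabilityMeasure P']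
      (Nν : ℝ≥0 → Ω' → ℕ), FracBD.IsFractionalLinearBirthDeath ν birth death P' Nν →
      ∀ t, IdentDistrib (Nν t) (fun ω => N (T t ω) ω) P' P := by
  obtain ⟨f, hf, hfN⟩ := hN.exists_stateProb
  have hX : ∀ t, Measurable fun ω => N (T t ω) ω := fun t =>
    (FracBD.measurable_uncurry_of_right_continuous hN.measurable hN.right_continuous).comp
      ((hTmeas t).prodMk measurable_id)
  have hcomp : ∀ (t : ℝ≥0) k, Integrable (fun x => f k |x|) (q t) ∧
      P.real {ω | N (T t ω) ω = k} = ∫ x, f k |x| ∂(q t) := by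
    intro t k
    have := hq.isProbabilityMeasure t t.2
    obtain ⟨hm, he⟩ := FracBD.measure_comp_eq_lintegral hN.measurable hN.right_continuous
      (hTmeas t) (hindep t) k
    -- Measurability is drawn from the process, which also covers `k = 0`, where no equation is at
    -- hand.
    have hmr : Measurable fun s : ℝ≥0 => f k s := by
      simp only [← hfN]
      exact hm.ennreal_toReal
    constructor
    · refine .of_bound (C := 1) ?_ (Filter.Eventually.of_forall fun x =>
        hf.abs_le_one k (abs_nonneg x))
      exact (hmr.comp (g := fun s : ℝ≥0 => f k s) (f := Real.nnabs)
        FracBD.continuous_nnabs.measurable).aestronglyMeasurable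
    · rw [measureReal_def, he, ← integral_toReal hm.aemeasurable
        (Filter.Eventually.of_forall fun s => measure_lt_top _ _), hTlaw]
      simp only [← measureReal_def, hfN]
      rw [FracBD.integral_fold hmr]
      simp only [Real.coe_nnabs]
  have hstate : ∀ k t, 0 ≤ t → FracBD.stateProb P (fun t ω => N (T t ω) ω) k t
      = ∫ x, f k |x| ∂(q t) := fun k t ht => by
    have := (hcomp t.toNNReal k).2
    rw [Real.coe_toNNReal t ht] at this
    exact this
  have hmain : FracBD.IsFractionalLinearBirthDeath ν birth death P
      (fun t ω => N (T t ω) ω) := by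
    refine ⟨hX, fun k t _ => measureReal_nonneg,
      fun t _ => FracBD.hasSum_measureReal_fiber P (hX t.toNNReal), fun k => ?_, fun k hk => ?_⟩
    · rw [hstate k 0 le_rfl, hq.integral_zero, abs_zero, hf.initial]
    -- Subordination turns the classical derivative of `f k` into the Caputo derivative; the right
    -- side, being linear in the probabilities, is averaged term by term.
    · refine hq.hasCaputoDeriv_integral_abs hν0 hν1 (hf.continuousOn hk) (hf.continuousOn_rhs hk)
        (fun s hs => ?_) (fun s hs => hf.abs_le_one k hs) (fun s hs => hf.abs_rhs_le k hs)
        (hstate k) (fun t ht => ?_)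
      · simpa using (hf.equation k hk).eq_of_integer (by simp) s hs
      · have hi : ∀ j, Integrable (fun x => f j |x|) (q t) := fun j => by
          have := (hcomp t.toNNReal j).1
          rwa [Real.coe_toNNReal t ht] at this
        simp only [hstate _ t ht]
        rw [integral_add (f := fun x => -(birth + death) * k * f k |x|
          + birth * ((k : ℝ) - 1) * f (k - 1) |x|) (((hi k).const_mul _).add ((hi (k - 1)).const_mul _))
          ((hi (k + 1)).const_mul _), integral_add ((hi k).const_mul _) ((hi (k - 1)).const_mul _),
          integral_const_mul, integral_const_mul, integral_const_mul]
  refine ⟨hmain, fun P' _ Nν hNν t => ?_⟩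
  refine ⟨(hNν.measurable t).aemeasurable, (hX t).aemeasurable, ?_⟩
  refine Measure.ext_of_singleton fun k => ?_
  rw [Measure.map_apply (hNν.measurable t) (measurableSet_singleton k),
    Measure.map_apply (hX t) (measurableSet_singleton k)]
  have h := hNν.stateProb_solves.unique hmain.stateProb_solves hν0 hν1 hbirth hdeath k
    (NNReal.coe_nonneg t)
  rw [FracBD.stateProb, FracBD.stateProb, Real.toNNReal_coe] at h
  exact (measureReal_eq_measureReal_iff (measure_ne_top _ _) (measure_ne_top _ _)).1 h
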